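/- Let $1\le k\le d$, let $p\ge 1$ be real, and let $\mathcal X=\{x_1,\dots,x_N\}\subset\mathbb R^d$ be a set of $N$ distinct points. Let $S_{d,k}=\{E\in\mathbb R^{d\times k}:E^\top E=I_k\}$, and let $\mu$ be a finite Borel measure on $S_{d,k}$. For $E\in S_{d,k}$ let $\mathcal X_E=(E^\top x_1,\dots,E^\top x_N)$. For points $\mathcal Y=(y_1,\dots,y_N)$ in $\mathbb R^k$ and probability vectors $a,b\in\mathbb R_{\ge0}^N$, let $$W_p(a,b;\mathcal Y)=\Big\{\min_{\pi}\sum_{i,j}\|y_i-y_j\|^p\pi_{ij}\Big\}^{1/p},$$ where the minimum is over all $\pi\in\mathbb R_{\ge0}^{N\times N}$ with row sums $a$ and column sums $b$, and let $$\mathrm{IW}_p(a,b)=\Big(\int_{S_{d,k}}W_p^p(a,b;\mathcal X_E)\,d\mu(E)\Big)^{1/p}.$$ Define $$\Phi_p^*(\mathcal Y)=\{u\in\mathbb R^N: u_i-u_j\le\|y_i-y_j\|^p\ \ \forall i,j\},$$ $$\Phi_p^*(a,b;\mathcal Y)=\{(u,v)\in\mathbb R^N\times\mathbb R^N:\langle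 u,a\rangle+\langle v,b\rangle=W_p^p(a,b;\mathcal Y),\ u_i+v_j\le\|y_i-y_j\|^p\ \ \forall i,j\}.$$ Let $r,s\in\mathbb R_{>0}^N$ be two probability vectors with strictly positive entries, regarded as distributions on $\mathcal X$. Let $X_1,X_2,\dots\sim r$ and $Y_1,Y_2,\dots\sim s$ be two independent sequences of i.i.d. random points of $\mathcal X$, and let $\hat r_n,\hat s_m$ be the empirical distributions of $X_1,\dots,X_n$ and of $Y_1,\dots,Y_m$, that is, $\hat r_{n,i}=\#\{l\le n:X_l=x_i\}/n$ and $\hat s_{m,i}=\#\{l\le m:Y_l=x_i\}/m$. Let $\Sigma(r)$ be the $N\times N$ matrix with diagonal entries $r_i(1-r_i)$ and off-diagonal entries $-r_ir_j$, and let $G\sim N(0,\Sigma(r))$ and $H\sim N(0,\Sigma(s))$ be independent Gaussian vectors. Let $\delta\in(0,1)$, and let $n,m\to\infty$ with $m/(n+m)\to\delta$. (i) If $r=s$, then $$\Big(\frac{nm}{n+m}\Big)^{\frac1{2p}}\mathrm{IW}_p(\hat r_n,\hat s_m)\ \xrightarrow{\ d\ }\ \Big(\int_{S_{d,k}}\max_{u\in\Phi_p^*(\mathcal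 X_E)}\langle G,u\rangle\,d\mu(E)\Big)^{1/p}.$$ (ii) If $r\ne s$, and if $p=1$ or $\mathrm{IW}_p(r,s)>0$, then $$\sqrt{\frac{nm}{n+m}}\,\big\{\mathrm{IW}_p(\hat r_n,\hat s_m)-\mathrm{IW}_p(r,s)\big\}\ \xrightarrow{\ d\ }\ \frac1p\,\mathrm{IW}_p^{1-p}(r,s)\int_{S_{d,k}}\max_{(u,v)\in\Phi_p^*(r,s;\mathcal X_E)}\Big(\sqrt\delta\,\langle G,u\rangle+\sqrt{1-\delta}\,\langle H,v\rangle\Big)\,d\mu(E),$$ where $\mathrm{IW}_p^{1-p}(r,s)=1$ if $p=1$. In both cases, almost surely the maxima are attained for every $E\in S_{d,k}$ and are $\mu$-integrable as functions of $E$. -/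

import Mathlib

open MeasureTheory ProbabilityTheory Filter Topology Matrix

noncomputable section

namespace IPRW

/-- The set `S_{d,k}` of real `d × k` matrices with orthonormal columns. -/
def Stiefel (d k : ℕ) : Type :=
  {E : Matrix (Fin d) (Fin k) ℝ // Eᵀ * E = 1}

instance (d k : ℕ) : TopologicalSpace (Stiefel d k) :=
  inferInstanceAs (TopologicalSpace {E : Matrix (Fin d) (Fin k) ℝ // Eᵀ * E = 1})

instance (d k : ℕ) : MeasurableSpace (Stiefel d k) := borel _

instance (d k : ℕ) : BorelSpace (Stiefel d k) := ⟨rfl⟩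

/-- The projected points `Eᵀ x₁, …, Eᵀ x_N` in `ℝᵏ` (as an indexed family: distinct points may be
projected to the same point). -/
def projPoints {d k N : ℕ} (x : Fin N → EuclideanSpace ℝ (Fin d)) (E : Stiefel d k) :
    Fin N → EuclideanSpace ℝ (Fin k) :=
  fun i => Matrix.toEuclideanLin (E.1)ᵀ (x i)

/-- The set `Δ_N` of probability vectors with strictly positive entries. -/
def simplex (N : ℕ) : Set (Fin N → ℝ) :=
  {r | (∀ i, 0 < r i) ∧ ∑ i, r i = 1}

/-- The probability measure `∑ i, r i • δ_{x i}` on `ℝᵈ` represented by the vector `r`. -/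
def discreteLaw {d N : ℕ} (x : Fin N → EuclideanSpace ℝ (Fin d)) (r : Fin N → ℝ) :
    Measure (EuclideanSpace ℝ (Fin d)) :=
  ∑ i, ENNReal.ofReal (r i) • Measure.dirac (x i)

/-- The couplings `Π(r, s)`: nonnegative matrices with row sums `r` and column sums `s`. -/
def couplings {N : ℕ} (r s : Fin N → ℝ) : Set (Matrix (Fin N) (Fin N) ℝ) :=
  {π | (∀ i j, 0 ≤ π i j) ∧ (∀ i, ∑ j, π i j = r i) ∧ (∀ j, ∑ i, π i j = s j)}

/-- The `p`-Wasserstein distance `W_p(r, s; {y₁, …, y_N})`; for probability vectors `r`, `s` the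
infimum is over a nonempty compact set, hence a minimum. -/
def wasserstein {k N : ℕ} (p : ℝ) (y : Fin N → EuclideanSpace ℝ (Fin k)) (r s : Fin N → ℝ) : ℝ :=
  (sInf ((fun π : Matrix (Fin N) (Fin N) ℝ => ∑ i, ∑ j, ‖y i - y j‖ ^ p * π i j) ''
    couplings r s)) ^ (1 / p)

/-- The integral projection robust Wasserstein distance `IW_p(r, s)`. -/
def IW {d k N : ℕ} (p : ℝ) (μ : Measure (Stiefel d k)) (x : Fin N → EuclideanSpace ℝ (Fin d))
    (r s : Fin N → ℝ) : ℝ :=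
  (∫ E, wasserstein p (projPoints x E) r s ^ p ∂μ) ^ (1 / p)

/-- The set `Φ*_p({y₁, …, y_N})`. -/
def potentials {k N : ℕ} (p : ℝ) (y : Fin N → EuclideanSpace ℝ (Fin k)) : Set (Fin N → ℝ) :=
  {u | ∀ i j, u i - u j ≤ ‖y i - y j‖ ^ p}

/-- The set `Φ*_p(r, s; {y₁, …, y_N})` of optimal dual pairs `(u, v)`. -/
def optimalDuals {k N : ℕ} (p : ℝ) (y : Fin N → EuclideanSpace ℝ (Fin k)) (r s : Fin N → ℝ) :
    Set ((Fin N → ℝ) × (Fin N → ℝ)) :=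
  {w | w.1 ⬝ᵥ r + w.2 ⬝ᵥ s = wasserstein p y r s ^ p ∧
    ∀ i j, w.1 i + w.2 j ≤ ‖y i - y j‖ ^ p}

/-- The values `⟨g, u⟩` for `u ∈ Φ*_p({y₁, …, y_N})`. -/
def potentialValues {k N : ℕ} (p : ℝ) (y : Fin N → EuclideanSpace ℝ (Fin k))
    (g : Fin N → ℝ) : Set ℝ :=
  (fun u => g ⬝ᵥ u) '' potentials p y

/-- The values `⟨g, u⟩ + ⟨h, v⟩` for `(u, v) ∈ Φ*_p(r, s; {y₁, …, y_N})`. -/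
def optimalDualValues {k N : ℕ} (p : ℝ) (y : Fin N → EuclideanSpace ℝ (Fin k))
    (r s g h : Fin N → ℝ) : Set ℝ :=
  (fun w => g ⬝ᵥ w.1 + h ⬝ᵥ w.2) '' optimalDuals p y r s

/-- The multinomial covariance matrix `Σ(r)`. -/
def covMatrix {N : ℕ} (r : Fin N → ℝ) : Matrix (Fin N) (Fin N) ℝ :=
  Matrix.of fun i j => if i = j then r i * (1 - r i) else -(r i * r j)

open Classical in
/-- The empirical frequencies of the points `x i` among the first `n` samples. -/
def empirical {Ω : Type*} {d N : ℕ} (x : Fin N → EuclideanSpace ℝ (Fin d))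
    (X : ℕ → Ω → EuclideanSpace ℝ (Fin d)) (n : ℕ) (ω : Ω) : Fin N → ℝ :=
  fun i => (((Finset.range n).filter fun l => X l ω = x i).card : ℝ) / n

end IPRW

end

noncomputable section

namespace IPRW

/-! `IW_p ^ p` is an integral over `E` of transport costs. By Kantorovich duality each cost is a
supremum of functionals linear in the marginals, `(a, b) ↦ ⟨u, a⟩ + ⟨u^c, b⟩` with `u^c` the
`c`-transform, and one compact cube of potentials `u` serves every `E` (`transportCost_eq_sSup`,
`supportFun_projDual`). Such a support function is Lipschitz, and its one-sided directional
derivative is the maximum over the functionals active at the base point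
(`tendsto_supportQuotient_zero`). Hence the difference quotient, completed by this derivative at
step zero, is continuous in step and direction, also after integration over `E`
(`continuous_integral_supportQuotient`).

This turns the delta method into the continuous mapping theorem. The empirical cost equals the base
cost plus `ε` times the quotient, exactly, with `ε = (nm/(n+m))^(-1/2)` and direction the rescaled
errors (`integratedCost_add`, `marginals_empirical_eq`). The multinomial central limit theorem then
yields the quotient at step zero in a Gaussian direction (`tendstoInDistribution_comp_deviations`).

It remains to identify the limit. Since all entries of `r` and `s` are positive, every optimal dual
pair is, up to a constant, an active potential of the cube with its transform. The constant is
invisible because the Gaussian directions have mass zero almost surely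
(`isGreatest_optimalDualValues`, `ae_sum_eq_zero`). If `r = s`, the base cost vanishes, the optimal
pairs are `(u, -u)`, and `√δ G - √(1-δ) H` has the law of `G`. If `r ≠ s`, the outer power `1/p` is
absorbed by `dslope`, its slope function based at the limiting cost. -/

/-- The optimal transport cost between `a` and `b` for the cost matrix `c`. -/
def transportCost {N : ℕ} (c : Fin N → Fin N → ℝ) (a b : Fin N → ℝ) : ℝ :=
  sInf ((fun π : Matrix (Fin N) (Fin N) ℝ => ∑ i, ∑ j, c i j * π i j) '' couplings a b)

/-- The cost matrix `‖y i - y j‖ ^ p`. -/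
def powerCost {k N : ℕ} (p : ℝ) (y : Fin N → EuclideanSpace ℝ (Fin k)) : Fin N → Fin N → ℝ :=
  fun i j => ‖y i - y j‖ ^ p

/-- The `c`-transform of a potential. -/
def cTransform {N : ℕ} [NeZero N] (c : Fin N → Fin N → ℝ) (u : Fin N → ℝ) : Fin N → ℝ :=
  fun j => Finset.univ.inf' Finset.univ_nonempty fun i => c i j - u i

/-! ### Kantorovich duality for finite cost matrices -/

section Duality

variable {N : ℕ} {c : Fin N → Fin N → ℝ} {a b u v : Fin N → ℝ}

lemma transportCost_nonneg (hc : ∀ i j, 0 ≤ c i j) : 0 ≤ transportCost c a b := by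
  refine Real.sInf_nonneg ?_
  rintro _ ⟨π, hπ, rfl⟩
  exact Finset.sum_nonneg fun i _ => Finset.sum_nonneg fun j _ => mul_nonneg (hc i j) (hπ.1 i j)

lemma bddBelow_costs (hc : ∀ i j, 0 ≤ c i j) :
    BddBelow ((fun π : Matrix (Fin N) (Fin N) ℝ => ∑ i, ∑ j, c i j * π i j) '' couplings a b) := by
  refine ⟨0, ?_⟩
  rintro _ ⟨π, hπ, rfl⟩
  exact Finset.sum_nonneg fun i _ => Finset.sum_nonneg fun j _ => mul_nonneg (hc i j) (hπ.1 i j)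

lemma product_mem_couplings (ha : a ∈ stdSimplex ℝ (Fin N)) (hb : b ∈ stdSimplex ℝ (Fin N)) :
    Matrix.of (fun i j => a i * b j) ∈ couplings a b := by
  refine ⟨fun i j => mul_nonneg (ha.1 i) (hb.1 j), fun i => ?_, fun j => ?_⟩
  · simp [← Finset.mul_sum, hb.2]
  · simp [← Finset.sum_mul, ha.2]

lemma dual_value_eq {π : Matrix (Fin N) (Fin N) ℝ} (hπ : π ∈ couplings a b) (u v : Fin N → ℝ) :
    u ⬝ᵥ a + v ⬝ᵥ b = ∑ i, ∑ j, (u i + v j) * π i j := by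
  simp only [add_mul, Finset.sum_add_distrib, dotProduct]
  congr 1
  · simp [← Finset.mul_sum, hπ.2.1]
  · rw [Finset.sum_comm]
    simp [← Finset.mul_sum, hπ.2.2]

lemma weak_duality {π : Matrix (Fin N) (Fin N) ℝ} (hπ : π ∈ couplings a b)
    (huv : ∀ i j, u i + v j ≤ c i j) :
    u ⬝ᵥ a + v ⬝ᵥ b ≤ ∑ i, ∑ j, c i j * π i j := by
  rw [dual_value_eq hπ]
  exact Finset.sum_le_sum fun i _ => Finset.sum_le_sum fun j _ =>
    mul_le_mul_of_nonneg_right (huv i j) (hπ.1 i j)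

lemma dual_value_le_transportCost (ha : a ∈ stdSimplex ℝ (Fin N)) (hb : b ∈ stdSimplex ℝ (Fin N))
    (huv : ∀ i j, u i + v j ≤ c i j) :
    u ⬝ᵥ a + v ⬝ᵥ b ≤ transportCost c a b := by
  refine le_csInf ⟨_, _, product_mem_couplings ha hb, rfl⟩ ?_
  rintro _ ⟨π, hπ, rfl⟩
  exact weak_duality hπ huv

/-- Approximate strong duality, by separation of the attainable triples (row sums, column sums,
cost) from the half-line below the optimal cost. -/
lemma exists_dual_value_gt (hc : ∀ i j, 0 ≤ c i j) (ha : a ∈ stdSimplex ℝ (Fin N))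
    (hb : b ∈ stdSimplex ℝ (Fin N)) {t : ℝ} (ht : t < transportCost c a b) :
    ∃ u v : Fin N → ℝ, (∀ i j, u i + v j ≤ c i j) ∧ t < u ⬝ᵥ a + v ⬝ᵥ b := by
  let T : (Fin N × Fin N → ℝ) →ₗ[ℝ] (Fin N → ℝ) × (Fin N → ℝ) × ℝ :=
    { toFun := fun π => (fun i => ∑ j, π (i, j), fun j => ∑ i, π (i, j),
        ∑ i, ∑ j, c i j * π (i, j))
      map_add' := fun π π' => by
        ext <;> simp [Finset.sum_add_distrib, mul_add]
      map_smul' := fun m π => by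
        ext <;> simp [Finset.mul_sum, mul_left_comm] }
  have hK : IsCompact (T '' stdSimplex ℝ (Fin N × Fin N)) :=
    (isCompact_stdSimplex ℝ (Fin N × Fin N)).image T.continuous_of_finiteDimensional
  have hKc : Convex ℝ (T '' stdSimplex ℝ (Fin N × Fin N)) :=
    (convex_stdSimplex ℝ (Fin N × Fin N)).linear_image T
  have hLc : Convex ℝ (({a} : Set (Fin N → ℝ)) ×ˢ ({b} : Set (Fin N → ℝ)) ×ˢ Set.Iic t) :=
    (convex_singleton a).prod ((convex_singleton b).prod (convex_Iic t))
  have hL : IsClosed (({a} : Set (Fin N → ℝ)) ×ˢ ({b} : Set (Fin N → ℝ)) ×ˢ Set.Iic t) :=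
    isClosed_singleton.prod (isClosed_singleton.prod isClosed_Iic)
  have hdisj : Disjoint (T '' stdSimplex ℝ (Fin N × Fin N))
      (({a} : Set (Fin N → ℝ)) ×ˢ ({b} : Set (Fin N → ℝ)) ×ˢ Set.Iic t) := by
    rw [Set.disjoint_left]
    rintro _ ⟨π, hπ, rfl⟩ ⟨h1, h2, h3⟩
    have h1' : (fun i => ∑ j, π (i, j)) = a := h1
    have h2' : (fun j => ∑ i, π (i, j)) = b := h2
    have h3' : ∑ i, ∑ j, c i j * π (i, j) ≤ t := h3
    have hmem : Matrix.of (fun i j => π (i, j)) ∈ couplings a b :=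
      ⟨fun i j => hπ.1 (i, j), fun i => congrFun h1' i, fun j => congrFun h2' j⟩
    have := csInf_le (bddBelow_costs hc) ⟨_, hmem, rfl⟩
    exact absurd (this.trans h3') (not_le.2 ht)
  obtain ⟨f, s₁, s₂, hf1, hs, hf2⟩ := geometric_hahn_banach_compact_closed hKc hK hLc hL hdisj
  -- The separating functional is written in coordinates: `α` and `β` price the marginals, `l` the
  -- cost.
  let α : Fin N → ℝ := fun i => f (Pi.single i 1, 0, 0)
  let β : Fin N → ℝ := fun j => f (0, Pi.single j 1, 0)
  let l : ℝ := f (0, 0, 1)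
  have hf : ∀ (x y : Fin N → ℝ) (z : ℝ), f (x, y, z) = x ⬝ᵥ α + y ⬝ᵥ β + z * l := by
    intro x y z
    have hx : f (x, 0, 0) = x ⬝ᵥ α := by
      have : (x, (0 : Fin N → ℝ), (0 : ℝ)) = ∑ i, x i • (Pi.single i (1 : ℝ), 0, 0) := by
        rw [Prod.ext_iff, Prod.ext_iff]
        refine ⟨?_, ?_, ?_⟩
        · ext j; simp [Prod.fst_sum, Finset.sum_apply, Pi.single_apply]
        · simp [Prod.snd_sum]
        · simp [Prod.snd_sum]
      rw [this, map_sum]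
      exact Finset.sum_congr rfl fun i _ => by rw [map_smul, smul_eq_mul]
    have hy : f (0, y, 0) = y ⬝ᵥ β := by
      have : ((0 : Fin N → ℝ), y, (0 : ℝ)) = ∑ i, y i • (0, Pi.single i (1 : ℝ), 0) := by
        rw [Prod.ext_iff, Prod.ext_iff]
        refine ⟨?_, ?_, ?_⟩
        · simp [Prod.fst_sum]
        · ext j; simp [Prod.snd_sum, Prod.fst_sum, Finset.sum_apply, Pi.single_apply]
        · simp [Prod.snd_sum]
      rw [this, map_sum]
      exact Finset.sum_congr rfl fun i _ => by rw [map_smul, smul_eq_mul]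
    have hz : f (0, 0, z) = z * l := by
      have : ((0 : Fin N → ℝ), (0 : Fin N → ℝ), z) = z • (0, 0, (1 : ℝ)) := by simp
      rw [this, map_smul, smul_eq_mul]
    have : (x, y, z) = (x, 0, 0) + (0, y, 0) + (0, 0, z) := by simp
    rw [this, map_add, map_add, hx, hy, hz]
  -- Evaluation at the point masses, the vertices of the simplex, gives one inequality for each
  -- entry.
  have hvert : ∀ i j, α i + β j + c i j * l < s₁ := by
    intro i j
    have h := hf1 (T (Pi.single (i, j) 1)) ⟨_, single_mem_stdSimplex ℝ (i, j), rfl⟩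
    have hT : T (Pi.single (i, j) 1) = (Pi.single i 1, Pi.single j 1, c i j) := by
      rw [Prod.ext_iff, Prod.ext_iff]
      refine ⟨?_, ?_, ?_⟩
      · ext i'
        simp only [T, LinearMap.coe_mk, AddHom.coe_mk, Pi.single_apply, Prod.mk.injEq]
        by_cases h : i' = i <;> simp [h]
      · ext i'
        simp only [T, LinearMap.coe_mk, AddHom.coe_mk, Pi.single_apply, Prod.mk.injEq]
        by_cases h : i' = j <;> simp [h]
      · simp only [T, LinearMap.coe_mk, AddHom.coe_mk, Pi.single_apply, Prod.mk.injEq]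
        rw [Finset.sum_eq_single i, Finset.sum_eq_single j] <;> simp +contextual
    rw [hT, hf] at h
    simpa using h
  have hlow : ∀ z ≤ t, s₂ < a ⬝ᵥ α + b ⬝ᵥ β + z * l := by
    intro z hz
    rw [← hf]
    exact hf2 _ ⟨rfl, rfl, hz⟩
  -- A positive `l` would make the functional unbounded below on the half-line of costs.
  have hl0 : l ≤ 0 := by
    by_contra! hl
    have h1 := hlow (min t ((s₂ - (a ⬝ᵥ α + b ⬝ᵥ β)) / l)) (min_le_left _ _)
    have h2 : min t ((s₂ - (a ⬝ᵥ α + b ⬝ᵥ β)) / l) * l ≤ s₂ - (a ⬝ᵥ α + b ⬝ᵥ β) := by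
      calc _ ≤ (s₂ - (a ⬝ᵥ α + b ⬝ᵥ β)) / l * l :=
            mul_le_mul_of_nonneg_right (min_le_right _ _) hl.le
        _ = _ := div_mul_cancel₀ _ hl.ne'
    linarith
  have hmass : ∑ i, ∑ j, a i * b j = 1 := by simp [← Finset.mul_sum, ha.2, hb.2]
  -- If `l = 0`, averaging the vertex inequalities against the product coupling gives a value at
  -- most `s₁`, against the separation `s₁ < s₂`.
  have hl : l < 0 := by
    refine lt_of_le_of_ne hl0 fun hl => ?_
    have h1 := hlow t le_rfl
    have h2 := weak_duality (product_mem_couplings ha hb) (u := α) (v := β) (c := fun _ _ => s₁)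
      (fun i j => by have := hvert i j; rw [hl] at this; linarith)
    simp only [Matrix.of_apply, ← Finset.mul_sum] at h2
    rw [Finset.mul_sum] at h2
    simp only [← Finset.mul_sum, hb.2, ha.2, mul_one] at h2
    rw [hl, dotProduct_comm a, dotProduct_comm b] at h1
    linarith
  -- Division by `-l > 0` gives the cost coefficient one; the threshold `s₁` is absorbed into the
  -- first potential.
  refine ⟨fun i => (α i - s₁) / (-l), fun j => β j / (-l), fun i j => ?_, ?_⟩
  · rw [← add_div, div_le_iff₀ (by linarith)]
    have := hvert i j
    linarith
  · have h1 := hlow t le_rfl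
    have e1 : (fun i => (α i - s₁) / (-l)) ⬝ᵥ a + (fun j => β j / (-l)) ⬝ᵥ b
        = (a ⬝ᵥ α + b ⬝ᵥ β - s₁) / (-l) := by
      have h3 : ∑ i, (α i - s₁) / (-l) * a i = (∑ i, a i * α i - s₁) / (-l) := by
        have : ∑ i, a i * α i - s₁ = ∑ i, (α i - s₁) * a i := by
          simp only [sub_mul, Finset.sum_sub_distrib, ← Finset.mul_sum, ha.2, mul_one]
          simp [mul_comm]
        rw [this, Finset.sum_div]
        exact Finset.sum_congr rfl fun i _ => by ring
      have h4 : ∑ i, β i / (-l) * b i = (∑ i, b i * β i) / (-l) := by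
        rw [Finset.sum_div]
        exact Finset.sum_congr rfl fun i _ => by ring
      simp only [dotProduct]
      rw [h3, h4]
      ring
    rw [e1, lt_div_iff₀ (by linarith)]
    linarith

lemma dotProduct_sub_const {t : ℝ} (ha : ∑ i, a i = 1) : (fun i => u i - t) ⬝ᵥ a = u ⬝ᵥ a - t := by
  simp [dotProduct, sub_mul, Finset.sum_sub_distrib, ← Finset.mul_sum, ha]

lemma dotProduct_le_of_le (ha : a ∈ stdSimplex ℝ (Fin N)) (huv : ∀ i, u i ≤ v i) :
    u ⬝ᵥ a ≤ v ⬝ᵥ a :=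
  Finset.sum_le_sum fun i _ => mul_le_mul_of_nonneg_right (huv i) (ha.1 i)

/-- This is how positivity of all entries enters: comparable potentials with equal averages must
agree everywhere. -/
lemma eq_of_dotProduct_le (ha : ∀ i, 0 < a i) (huv : ∀ i, u i ≤ v i)
    (h : v ⬝ᵥ a ≤ u ⬝ᵥ a) : u = v := by
  have h1 : ∀ i ∈ Finset.univ, u i * a i ≤ v i * a i := fun i _ =>
    mul_le_mul_of_nonneg_right (huv i) (ha i).le
  have h2 := (Finset.sum_eq_sum_iff_of_le h1).1 (le_antisymm (Finset.sum_le_sum h1) h)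
  ext i
  exact mul_right_cancel₀ (ha i).ne' (h2 i (Finset.mem_univ i))

lemma simplex_subset_stdSimplex : simplex N ⊆ stdSimplex ℝ (Fin N) :=
  fun _ ha => ⟨fun i => (ha.1 i).le, ha.2⟩

lemma transportCost_self (hc0 : ∀ i j, 0 ≤ c i j) (hdiag : ∀ i, c i i = 0)
    (ha : a ∈ stdSimplex ℝ (Fin N)) : transportCost c a a = 0 := by
  refine le_antisymm ?_ (transportCost_nonneg hc0)
  refine csInf_le (bddBelow_costs hc0)
    ⟨Matrix.diagonal a, ⟨fun i j => ?_, fun i => ?_, fun j => ?_⟩, ?_⟩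
  · by_cases h : i = j
    · subst h; simpa using ha.1 i
    · simp [h]
  · simp [Matrix.diagonal_apply]
  · simp [Matrix.diagonal_apply]
  · simp [Matrix.diagonal_apply, hdiag]

/-- The cube of potentials bounded by `C`. -/
def potentialBox (N : ℕ) (C : ℝ) : Set (Fin N → ℝ) := Set.Icc (fun _ => -C) (fun _ => C)

lemma mem_potentialBox {C : ℝ} : u ∈ potentialBox N C ↔ ∀ i, |u i| ≤ C := by
  simp [potentialBox, Set.mem_Icc, Pi.le_def, abs_le, forall_and]

/-! ### `c`-transforms and bounded dual potentials -/

section CTransform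

variable [NeZero N]

lemma le_cTransform_iff (j : Fin N) (t : ℝ) : t ≤ cTransform c u j ↔ ∀ i, u i + t ≤ c i j := by
  simp [cTransform, Finset.le_inf'_iff, le_sub_iff_add_le']

lemma add_cTransform_le (i j : Fin N) : u i + cTransform c u j ≤ c i j :=
  (le_cTransform_iff j _).1 le_rfl i

lemma exists_cTransform_eq (j : Fin N) : ∃ i, u i + cTransform c u j = c i j := by
  obtain ⟨i, -, hi⟩ := Finset.exists_mem_eq_inf' Finset.univ_nonempty fun i => c i j - u i
  exact ⟨i, by rw [cTransform, hi]; ring⟩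

lemma cTransform_sub_const (t : ℝ) (j : Fin N) :
    cTransform c (fun i => u i - t) j = cTransform c u j + t := by
  refine le_antisymm ?_ ?_
  · rw [← sub_le_iff_le_add, le_cTransform_iff]
    intro i
    linarith [add_cTransform_le (c := c) (u := fun i => u i - t) i j]
  · rw [le_cTransform_iff]
    intro i
    linarith [add_cTransform_le (c := c) (u := u) i j]

/-- Potentials that are `c`-transforms of some function oscillate at most as much as the cost. -/
lemma sub_le_of_eq_cTransform {C : ℝ} (hc0 : ∀ i j, 0 ≤ c i j) (hcC : ∀ i j, c i j ≤ C)
    {w : Fin N → ℝ} (i i' : Fin N) :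
    cTransform c w i - cTransform c w i' ≤ C := by
  obtain ⟨l, hl⟩ := exists_cTransform_eq (c := c) (u := w) i'
  linarith [add_cTransform_le (c := c) (u := w) l i, hc0 l i', hcC l i]

lemma abs_cTransform_le {C : ℝ} (hc0 : ∀ i j, 0 ≤ c i j) (hcC : ∀ i j, c i j ≤ C)
    (hu : ∀ i, |u i| ≤ C) (j : Fin N) : |cTransform c u j| ≤ 2 * C := by
  obtain ⟨i, hi⟩ := exists_cTransform_eq (c := c) (u := u) j
  have := abs_le.1 (hu i)
  rw [abs_le]
  constructor <;> linarith [hc0 i j, hcC i j, (abs_nonneg (u i)).trans (hu i)]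

lemma le_cTransform (huv : ∀ i j, u i + v j ≤ c i j) (j : Fin N) : v j ≤ cTransform c u j :=
  (le_cTransform_iff j _).2 fun i => huv i j

/-- Normalizing to zero at index `0` turns the oscillation bound into a uniform bound. -/
lemma sub_const_mem_potentialBox {C : ℝ} (hc0 : ∀ i j, 0 ≤ c i j) (hcC : ∀ i j, c i j ≤ C)
    (w : Fin N → ℝ) :
    (fun i => cTransform c w i - cTransform c w 0) ∈ potentialBox N C := by
  refine mem_potentialBox.2 fun i => abs_le.2 ⟨?_, sub_le_of_eq_cTransform hc0 hcC i 0⟩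
  linarith [sub_le_of_eq_cTransform (w := w) hc0 hcC 0 i]

/-- Both marginals have mass one, so opposite shifts of the two potentials cancel. -/
lemma dual_value_sub_const (ha : a ∈ stdSimplex ℝ (Fin N)) (hb : b ∈ stdSimplex ℝ (Fin N))
    (t : ℝ) :
    (fun i => u i - t) ⬝ᵥ a + cTransform c (fun i => u i - t) ⬝ᵥ b
      = u ⬝ᵥ a + cTransform c u ⬝ᵥ b := by
  have h : cTransform c (fun i => u i - t) = fun j => cTransform c u j - (-t) := by
    ext j
    rw [cTransform_sub_const, sub_neg_eq_add]
  rw [h, dotProduct_sub_const ha.2, dotProduct_sub_const hb.2]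
  ring

/-- The double transform improves any feasible pair: `u ≤ u^cc` and `v ≤ u^c ≤ u^ccc`. Symmetry of
the cost lets the same transform act on both sides. -/
lemma exists_mem_potentialBox_dual_value_ge {C : ℝ} (hc0 : ∀ i j, 0 ≤ c i j)
    (hcC : ∀ i j, c i j ≤ C) (hsymm : ∀ i j, c i j = c j i)
    (ha : a ∈ stdSimplex ℝ (Fin N)) (hb : b ∈ stdSimplex ℝ (Fin N))
    (huv : ∀ i j, u i + v j ≤ c i j) :
    ∃ u' ∈ potentialBox N C, u ⬝ᵥ a + v ⬝ᵥ b ≤ u' ⬝ᵥ a + cTransform c u' ⬝ᵥ b := by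
  refine ⟨_, sub_const_mem_potentialBox hc0 hcC (cTransform c u), ?_⟩
  rw [dual_value_sub_const ha hb]
  refine add_le_add (dotProduct_le_of_le ha fun i => le_cTransform (fun j i => ?_) i)
    (dotProduct_le_of_le hb fun j => ?_)
  · rw [hsymm, add_comm]
    exact add_cTransform_le i j
  · refine (le_cTransform huv j).trans (le_cTransform (fun i j => ?_) j)
    rw [hsymm, add_comm]
    exact add_cTransform_le j i

/-- Kantorovich duality with uniformly bounded potentials. -/
lemma transportCost_eq_sSup {C : ℝ} (hc0 : ∀ i j, 0 ≤ c i j)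
    (hcC : ∀ i j, c i j ≤ C) (hsymm : ∀ i j, c i j = c j i)
    (ha : a ∈ stdSimplex ℝ (Fin N)) (hb : b ∈ stdSimplex ℝ (Fin N)) :
    transportCost c a b
      = sSup ((fun u => u ⬝ᵥ a + cTransform c u ⬝ᵥ b) '' potentialBox N C) := by
  have hle : ∀ y ∈ (fun u => u ⬝ᵥ a + cTransform c u ⬝ᵥ b) '' potentialBox N C,
      y ≤ transportCost c a b := by
    rintro _ ⟨u, -, rfl⟩
    exact dual_value_le_transportCost ha hb add_cTransform_le
  refine le_antisymm (le_of_forall_lt fun t ht => ?_) (csSup_le ?_ hle)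
  · obtain ⟨u, v, huv, htv⟩ := exists_dual_value_gt hc0 ha hb ht
    obtain ⟨u', hu', h⟩ := exists_mem_potentialBox_dual_value_ge hc0 hcC hsymm ha hb huv
    exact (htv.trans_le h).trans_le (le_csSup ⟨_, hle⟩ ⟨u', hu', rfl⟩)
  · exact Set.Nonempty.image _ ⟨0, mem_potentialBox.2 fun i => by
      simpa using (hc0 i i).trans (hcC i i)⟩

/-- The transform is the largest feasible partner of `u`; if it exceeded `v` anywhere, positivity of
`b` would make the value exceed the optimum. -/
lemma eq_cTransform_of_optimal (ha : a ∈ simplex N) (hb : b ∈ simplex N)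
    (huv : ∀ i j, u i + v j ≤ c i j) (hopt : u ⬝ᵥ a + v ⬝ᵥ b = transportCost c a b) :
    v = cTransform c u := by
  refine eq_of_dotProduct_le hb.1 (le_cTransform huv) ?_
  have := dual_value_le_transportCost (simplex_subset_stdSimplex ha) (simplex_subset_stdSimplex hb)
    (add_cTransform_le (c := c) (u := u))
  linarith

/-- Up to a constant, an optimal dual pair consists of a bounded potential and its transform. -/
lemma exists_shift_of_optimal {C : ℝ} (hc0 : ∀ i j, 0 ≤ c i j)
    (hcC : ∀ i j, c i j ≤ C) (hsymm : ∀ i j, c i j = c j i) (ha : a ∈ simplex N)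
    (hb : b ∈ simplex N) (huv : ∀ i j, u i + v j ≤ c i j)
    (hopt : u ⬝ᵥ a + v ⬝ᵥ b = transportCost c a b) :
    ∃ t, (fun i => u i - t) ∈ potentialBox N C ∧
      cTransform c (fun i => u i - t) = fun j => v j + t := by
  have hv := eq_cTransform_of_optimal ha hb huv hopt
  have ha' := simplex_subset_stdSimplex ha
  have hb' := simplex_subset_stdSimplex hb
  have hvu : ∀ i j, v i + u j ≤ c i j := fun i j => by rw [hsymm, add_comm]; exact huv j i
  -- By the symmetric argument each potential is the transform of the other, so `u` has oscillation
  -- at most `C`.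
  have hu : u = cTransform c v := by
    refine eq_of_dotProduct_le ha.1 (le_cTransform hvu) ?_
    have := dual_value_le_transportCost (u := cTransform c v) (v := v) (c := c) ha' hb'
      (fun i j => by rw [hsymm, add_comm]; exact add_cTransform_le j i)
    linarith
  refine ⟨u 0, ?_, ?_⟩
  · have := sub_const_mem_potentialBox hc0 hcC v
    rwa [← hu] at this
  · ext j
    rw [cTransform_sub_const, ← hv]

lemma continuous_cTransform_uncurry (j : Fin N) :
    Continuous fun q : (Fin N → Fin N → ℝ) × (Fin N → ℝ) => cTransform q.1 q.2 j := by
  unfold cTransform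
  refine Continuous.finset_inf'_apply _ fun i _ => ?_
  fun_prop

end CTransform
end Duality

/-! ### Costs `‖y i - y j‖ ^ p` and the case of equal marginals -/

section PowerCost

variable {k N : ℕ} {p : ℝ} {y : Fin N → EuclideanSpace ℝ (Fin k)} {r s : Fin N → ℝ}

lemma powerCost_nonneg (i j : Fin N) : 0 ≤ powerCost p y i j :=
  Real.rpow_nonneg (norm_nonneg _) _

lemma powerCost_symm (i j : Fin N) : powerCost p y i j = powerCost p y j i := by
  simp [powerCost, norm_sub_rev]

lemma powerCost_self (hp : 1 ≤ p) (i : Fin N) : powerCost p y i i = 0 := by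
  simp [powerCost, Real.zero_rpow (by linarith : p ≠ 0)]

lemma wasserstein_rpow (hp : 1 ≤ p) :
    wasserstein p y r s ^ p = transportCost (powerCost p y) r s := by
  have h : wasserstein p y r s = transportCost (powerCost p y) r s ^ (1 / p) := rfl
  rw [h, ← Real.rpow_mul (transportCost_nonneg powerCost_nonneg),
    one_div_mul_cancel (by linarith), Real.rpow_one]

/-- Between a distribution and itself, the optimal dual pairs are `(u, -u)` with `u` a
potential. -/
lemma optimalDualValues_self (hp : 1 ≤ p) (hr : r ∈ simplex N) (g h : Fin N → ℝ) :
    optimalDualValues p y r r g h = potentialValues p y (g - h) := by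
  have hW : wasserstein p y r r ^ p = 0 := by
    rw [wasserstein_rpow hp]
    exact transportCost_self powerCost_nonneg (powerCost_self hp)
      (⟨fun i => (hr.1 i).le, hr.2⟩)
  have key : ∀ w : (Fin N → ℝ) × (Fin N → ℝ), w ∈ optimalDuals p y r r ↔
      w.1 ∈ potentials p y ∧ w.2 = -w.1 := by
    rintro ⟨u, v⟩
    simp only [optimalDuals, potentials, Set.mem_ofPred_eq, hW]
    constructor
    · rintro ⟨h0, h1⟩
      -- The diagonal constraints, where the cost is zero, give `v ≤ -u`; the optimal value zero
      -- then forces equality.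
      have hle : ∀ i, v i ≤ (-u) i := fun i => by
        have := h1 i i
        simp only [sub_self, norm_zero, Real.zero_rpow (by linarith : p ≠ 0)] at this
        simp only [Pi.neg_apply]
        linarith
      have hvu : v = -u := by
        refine eq_of_dotProduct_le hr.1 hle ?_
        rw [neg_dotProduct]
        linarith
      subst hvu
      exact ⟨fun i j => by simpa [sub_eq_add_neg] using h1 i j, rfl⟩
    · rintro ⟨h1, rfl⟩
      exact ⟨by simp, fun i j => by simpa [sub_eq_add_neg] using h1 i j⟩
  ext t
  constructor
  · rintro ⟨⟨u, v⟩, hw, rfl⟩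
    obtain ⟨h1, h2⟩ := (key _).1 hw
    refine ⟨u, h1, ?_⟩
    simp only at h2
    simp [h2, sub_eq_add_neg]
  · rintro ⟨u, hu, rfl⟩
    exact ⟨(u, -u), (key _).2 ⟨hu, rfl⟩, by simp [sub_eq_add_neg]⟩

end PowerCost

/-! ### Support functions, their directional derivatives, and integration over a parameter -/

section SupportFunction

variable {Θ B W : Type*} [NormedAddCommGroup W] [NormedSpace ℝ W]
  {f : Θ → B → W →ₗ[ℝ] ℝ} {K : Set B} {M : ℝ} {θ : Θ} {w z z' : W} {ε : ℝ}

/-- The supremum over `b ∈ K` of the linear functionals `f θ b`. -/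
def supportFun (f : Θ → B → W →ₗ[ℝ] ℝ) (K : Set B) (θ : Θ) (w : W) : ℝ :=
  sSup ((fun b => f θ b w) '' K)

/-- The points of `K` at which the supremum defining `supportFun f K θ w` is attained. -/
def supportFace (f : Θ → B → W →ₗ[ℝ] ℝ) (K : Set B) (θ : Θ) (w : W) : Set B :=
  {b ∈ K | f θ b w = supportFun f K θ w}

/-- The one-sided directional derivative of `supportFun f K θ` at `w`. -/
def supportDeriv (f : Θ → B → W →ₗ[ℝ] ℝ) (K : Set B) (θ : Θ) (w z : W) : ℝ :=
  sSup ((fun b => f θ b z) '' supportFace f K θ w)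

open Classical in
/-- The difference quotient of `supportFun f K θ` at `w`, extended to nonpositive step sizes by the
directional derivative. -/
def supportQuotient (f : Θ → B → W →ₗ[ℝ] ℝ) (K : Set B) (w : W) (ε : ℝ) (θ : Θ) (z : W) : ℝ :=
  if 0 < ε then (supportFun f K θ (w + ε • z) - supportFun f K θ w) / ε
  else supportDeriv f K θ w z

lemma bddAbove_image_of_bounded {S : Set B} (hM : ∀ θ, ∀ b ∈ K, ∀ z, |f θ b z| ≤ M * ‖z‖)
    (hS : S ⊆ K) : BddAbove ((fun b => f θ b z) '' S) := by
  refine ⟨M * ‖z‖, ?_⟩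
  rintro _ ⟨b, hb, rfl⟩
  exact (le_abs_self _).trans (hM θ b (hS hb) z)

/-- Suprema of uniformly bounded families of linear functionals are Lipschitz. -/
lemma sSup_image_sub_le {S : Set B} (hM : ∀ θ, ∀ b ∈ K, ∀ z, |f θ b z| ≤ M * ‖z‖)
    (hS : S ⊆ K) (hS0 : S.Nonempty) (z z' : W) :
    sSup ((fun b => f θ b z) '' S) - sSup ((fun b => f θ b z') '' S) ≤ M * ‖z - z'‖ := by
  rw [sub_le_iff_le_add]
  refine csSup_le (hS0.image _) ?_
  rintro _ ⟨b, hb, rfl⟩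
  have h1 : f θ b z = f θ b (z - z') + f θ b z' := by simp
  have h2 := (le_abs_self _).trans (hM θ b (hS hb) (z - z'))
  have h3 := le_csSup (bddAbove_image_of_bounded (θ := θ) (z := z') hM hS) ⟨b, hb, rfl⟩
  simp only at h3 ⊢
  linarith

lemma abs_sSup_image_sub_le {S : Set B} (hM : ∀ θ, ∀ b ∈ K, ∀ z, |f θ b z| ≤ M * ‖z‖)
    (hS : S ⊆ K) (hS0 : S.Nonempty) (z z' : W) :
    |sSup ((fun b => f θ b z) '' S) - sSup ((fun b => f θ b z') '' S)| ≤ M * ‖z - z'‖ := by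
  refine abs_sub_le_iff.2 ⟨sSup_image_sub_le hM hS hS0 z z', ?_⟩
  rw [norm_sub_rev]
  exact sSup_image_sub_le hM hS hS0 z' z

lemma continuous_supportFun (hK0 : K.Nonempty)
    (hM : ∀ θ, ∀ b ∈ K, ∀ z, |f θ b z| ≤ M * ‖z‖) (θ : Θ) : Continuous (supportFun f K θ) := by
  have : LipschitzWith M.toNNReal (supportFun f K θ) := by
    refine LipschitzWith.of_dist_le_mul fun z z' => ?_
    rw [Real.dist_eq, dist_eq_norm]
    refine (abs_sSup_image_sub_le hM subset_rfl hK0 z z').trans ?_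
    gcongr
    exact Real.le_coe_toNNReal M
  exact this.continuous

lemma supportFace_subset : supportFace f K θ w ⊆ K := fun _ hb => hb.1

variable [TopologicalSpace Θ] [TopologicalSpace B]
  (hK : IsCompact K) (hK0 : K.Nonempty)
  (hf : ∀ z, Continuous fun q : Θ × B => f q.1 q.2 z)
  (hM : ∀ θ, ∀ b ∈ K, ∀ z, |f θ b z| ≤ M * ‖z‖)

lemma continuous_apply_of_uncurry (hf : ∀ z, Continuous fun q : Θ × B => f q.1 q.2 z) (θ : Θ)
    (z : W) : Continuous fun b => f θ b z :=
  (hf z).comp (by fun_prop : Continuous fun b => (θ, b))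

include hK hK0 hf in
lemma supportFace_nonempty (θ : Θ) (w : W) : (supportFace f K θ w).Nonempty := by
  have h := (hK.image (continuous_apply_of_uncurry hf θ w)).sSup_mem (hK0.image _)
  obtain ⟨b, hb, hbw⟩ := h
  exact ⟨b, hb, hbw⟩

include hK hf in
lemma isCompact_supportFace (θ : Θ) (w : W) : IsCompact (supportFace f K θ w) :=
  hK.inter_right (isClosed_eq (continuous_apply_of_uncurry hf θ w) continuous_const)

include hK hK0 hf in
lemma isGreatest_supportDeriv (θ : Θ) (w z : W) :
    IsGreatest ((fun b => f θ b z) '' supportFace f K θ w) (supportDeriv f K θ w z) :=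
  ((isCompact_supportFace hK hf θ w).image (continuous_apply_of_uncurry hf θ z)).isGreatest_sSup
    ((supportFace_nonempty hK hK0 hf θ w).image _)

include hK hf in
lemma continuous_supportFun_param (w : W) : Continuous fun θ => supportFun f K θ w :=
  hK.continuous_sSup (hf w)

include hK hK0 hf hM in
lemma abs_supportQuotient_sub_le (ε : ℝ) (θ : Θ) (z z' : W) :
    |supportQuotient f K w ε θ z - supportQuotient f K w ε θ z'| ≤ M * ‖z - z'‖ := by
  unfold supportQuotient
  split_ifs with hε
  · rw [← sub_div, abs_div, abs_of_pos hε, div_le_iff₀ hε]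
    have h := abs_sSup_image_sub_le (θ := θ) hM subset_rfl hK0 (w + ε • z) (w + ε • z')
    have e : w + ε • z - (w + ε • z') = ε • (z - z') := by rw [smul_sub]; abel
    rw [e, norm_smul, Real.norm_eq_abs, abs_of_pos hε] at h
    have e2 : supportFun f K θ (w + ε • z) - supportFun f K θ w
        - (supportFun f K θ (w + ε • z') - supportFun f K θ w)
        = supportFun f K θ (w + ε • z) - supportFun f K θ (w + ε • z') := by ring
    rw [e2]
    calc _ ≤ M * (ε * ‖z - z'‖) := h
      _ = _ := by ring
  · exact abs_sSup_image_sub_le hM supportFace_subset (supportFace_nonempty hK hK0 hf θ w) z z'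

include hK hK0 hf in
lemma supportQuotient_zero_right (ε : ℝ) (θ : Θ) : supportQuotient f K w ε θ 0 = 0 := by
  unfold supportQuotient
  split_ifs
  · simp
  · simp [supportDeriv, (supportFace_nonempty hK hK0 hf θ w).image_const]

include hK hK0 hf hM in
lemma abs_supportQuotient_le (ε : ℝ) (θ : Θ) (z : W) :
    |supportQuotient f K w ε θ z| ≤ M * ‖z‖ := by
  simpa [supportQuotient_zero_right hK hK0 hf] using
    abs_supportQuotient_sub_le (w := w) hK hK0 hf hM ε θ z 0

include hK hK0 hf hM in
-- A maximizer at `w` still competes at `w + ε • z`, where its value has grown by exactly `ε * f θ b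
-- z`.
lemma supportDeriv_le_supportQuotient (hε : 0 < ε) (θ : Θ) (z : W) :
    supportDeriv f K θ w z ≤ supportQuotient f K w ε θ z := by
  obtain ⟨⟨b, hb, hbz⟩, -⟩ := isGreatest_supportDeriv hK hK0 hf θ w z
  rw [supportQuotient, if_pos hε, le_div_iff₀ hε, ← hbz]
  have h := le_csSup (bddAbove_image_of_bounded (θ := θ) (z := w + ε • z) hM subset_rfl)
    ⟨b, hb.1, rfl⟩
  simp only [map_add, map_smul, smul_eq_mul] at h
  have h2 := hb.2
  rw [supportFun] at h2 ⊢
  simp only [map_add, map_smul, smul_eq_mul, supportFun]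
  linarith

include hK hK0 hf hM in
/-- The difference quotients converge to the directional derivative. -/
lemma tendsto_supportQuotient_zero (θ : Θ) (z : W) :
    Tendsto (fun ε => supportQuotient f K w ε θ z) (𝓝[>] 0) (𝓝 (supportDeriv f K θ w z)) := by
  refine tendsto_order.2 ⟨fun t ht => ?_, fun t ht => ?_⟩
  · filter_upwards [self_mem_nhdsWithin] with ε hε
    exact ht.trans_le (supportDeriv_le_supportQuotient hK hK0 hf hM hε θ z)
  obtain ⟨t', ht', htt⟩ := exists_between ht
  have hCc : IsCompact (K ∩ {b | t' ≤ f θ b z}) :=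
    hK.inter_right (isClosed_le continuous_const (continuous_apply_of_uncurry hf θ z))
  -- away from the optimal face, the functionals stay below the supremum by a margin
  obtain ⟨γ, hγ, hC⟩ : ∃ γ > 0, ∀ b ∈ K ∩ {b | t' ≤ f θ b z},
      f θ b w ≤ supportFun f K θ w - γ := by
    rcases (K ∩ {b | t' ≤ f θ b z}).eq_empty_or_nonempty with h0 | h0
    · exact ⟨1, one_pos, by simp [h0]⟩
    · obtain ⟨b, hb, hmax⟩ := hCc.exists_isMaxOn h0
        (continuous_apply_of_uncurry hf θ w).continuousOn
      have hle := le_csSup (bddAbove_image_of_bounded (θ := θ) (z := w) hM subset_rfl)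
        ⟨b, hb.1, rfl⟩
      have hne : f θ b w ≠ supportFun f K θ w := fun h => by
        have := (isGreatest_supportDeriv hK hK0 hf θ w z).2 ⟨b, ⟨hb.1, h⟩, rfl⟩
        exact absurd (hb.2.trans this) (not_le.2 ht')
      have hlt : f θ b w < supportFun f K θ w := lt_of_le_of_ne hle hne
      exact ⟨supportFun f K θ w - f θ b w, sub_pos.2 hlt, fun b' hb' => by
        have := hmax hb'
        simp only [Set.mem_ofPred_eq] at this
        linarith⟩
  -- For small `ε`, a gain of at most `ε * M * ‖z‖` cannot make up for the margin `γ`; the term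
  -- `|t'|` allows for negative `t'`.
  have hev : ∀ᶠ ε : ℝ in 𝓝[>] 0, ε * (M * ‖z‖ + |t'|) < γ := by
    have : Tendsto (fun ε : ℝ => ε * (M * ‖z‖ + |t'|)) (𝓝[>] 0) (𝓝 (0 * (M * ‖z‖ + |t'|))) :=
      (tendsto_id.mono_left nhdsWithin_le_nhds).mul_const _
    rw [zero_mul] at this
    exact this.eventually_lt_const hγ
  filter_upwards [hev, self_mem_nhdsWithin] with ε hεγ hε
  have hε : 0 < ε := hε
  refine lt_of_le_of_lt ?_ htt
  rw [supportQuotient, if_pos hε, div_le_iff₀ hε, sub_le_iff_le_add]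
  refine csSup_le (hK0.image _) ?_
  rintro _ ⟨b, hb, rfl⟩
  simp only [map_add, map_smul, smul_eq_mul]
  by_cases hbC : t' ≤ f θ b z
  · have h1 := hC b ⟨hb, hbC⟩
    have h2 := mul_le_mul_of_nonneg_left ((le_abs_self _).trans (hM θ b hb z)) hε.le
    have h3 := mul_le_mul_of_nonneg_left (neg_abs_le t') hε.le
    nlinarith
  · have h1 := le_csSup (bddAbove_image_of_bounded (θ := θ) (z := w) hM subset_rfl)
      ⟨b, hb, rfl⟩
    have h2 := mul_le_mul_of_nonneg_left (not_le.1 hbC).le hε.le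
    simp only [supportFun]
    simp only at h1
    linarith

include hK hK0 hf hM in
lemma continuous_supportQuotient_step (θ : Θ) (z : W) :
    Continuous fun ε => supportQuotient f K w ε θ z := by
  rw [continuous_iff_continuousAt]
  intro ε
  rcases lt_trichotomy ε 0 with hε | rfl | hε
  · have : (fun ε => supportQuotient f K w ε θ z) =ᶠ[𝓝 ε] fun _ => supportDeriv f K θ w z := by
      filter_upwards [eventually_lt_nhds hε] with e he
      simp [supportQuotient, not_lt.2 he.le]
    exact continuousAt_const.congr this.symm
  · have h0 : supportQuotient f K w 0 θ z = supportDeriv f K θ w z := by simp [supportQuotient]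
    have h1 := tendsto_supportQuotient_zero (w := w) hK hK0 hf hM θ z
    rw [← h0] at h1
    -- On the left the quotient is constant by convention; on the right it converges to the
    -- derivative.
    refine continuousAt_iff_continuous_left'_right'.2 ⟨?_, h1⟩
    have : (fun _ => supportDeriv f K θ w z) =ᶠ[𝓝[<] (0 : ℝ)]
        (fun ε => supportQuotient f K w ε θ z) := by
      filter_upwards [self_mem_nhdsWithin] with e he
      simp [supportQuotient, not_lt.2 (le_of_lt (Set.mem_Iio.1 he))]
    refine Tendsto.congr' this ?_
    simp only [h0]
    exact tendsto_const_nhds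
  · have : (fun ε => supportQuotient f K w ε θ z) =ᶠ[𝓝 ε]
        fun ε => (supportFun f K θ (w + ε • z) - supportFun f K θ w) / ε := by
      filter_upwards [eventually_gt_nhds hε] with e he
      simp [supportQuotient, he]
    refine ContinuousAt.congr ?_ this.symm
    have hc := continuous_supportFun (f := f) hK0 hM θ
    exact (by fun_prop : ContinuousAt (fun ε : ℝ => supportFun f K θ (w + ε • z) -
      supportFun f K θ w) ε).div continuousAt_id hε.ne'

variable [MeasurableSpace Θ] [OpensMeasurableSpace Θ]

include hK hK0 hf hM in
lemma measurable_supportQuotient (ε : ℝ) (z : W) :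
    Measurable fun θ => supportQuotient f K w ε θ z := by
  have hpos : ∀ ε > 0, Measurable fun θ => supportQuotient f K w ε θ z := by
    intro ε hε
    have e : (fun θ => supportQuotient f K w ε θ z) =
        fun θ => (supportFun f K θ (w + ε • z) - supportFun f K θ w) / ε := by
      ext θ; simp [supportQuotient, hε]
    rw [e]
    exact ((continuous_supportFun_param hK hf _).measurable.sub
      (continuous_supportFun_param hK hf _).measurable).div_const _
  rcases lt_or_ge 0 ε with hε | hε
  · exact hpos ε hε
  · have e : (fun θ => supportQuotient f K w ε θ z) = fun θ => supportDeriv f K θ w z := by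
      ext θ; simp [supportQuotient, not_lt.2 hε]
    rw [e]
    -- The derivative need not be continuous in `θ`, but it is a pointwise limit of continuous
    -- quotients.
    refine measurable_of_tendsto_metrizable (f := fun (n : ℕ) θ =>
      supportQuotient f K w (1 / ((n : ℝ) + 1)) θ z) (fun n => hpos _ (by positivity)) ?_
    refine tendsto_pi_nhds.2 fun θ => ?_
    refine (tendsto_supportQuotient_zero hK hK0 hf hM θ z).comp
      (tendsto_nhdsWithin_iff.2 ⟨tendsto_one_div_add_atTop_nhds_zero_nat, ?_⟩)
    exact Eventually.of_forall fun n => by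
      simp only [Set.mem_Ioi]; positivity

variable (μ : Measure Θ) [IsFiniteMeasure μ]

include hK hK0 hf hM in
lemma integrable_supportQuotient (ε : ℝ) (z : W) :
    Integrable (fun θ => supportQuotient f K w ε θ z) μ :=
  Integrable.of_bound (measurable_supportQuotient hK hK0 hf hM ε z).aestronglyMeasurable
    (M * ‖z‖) (ae_of_all _ fun θ => abs_supportQuotient_le hK hK0 hf hM ε θ z)

include hK hK0 hf hM in
/-- The integrated difference quotients are jointly continuous in the step size and the
direction. -/
lemma continuous_integral_supportQuotient (w : W) :
    Continuous fun q : ℝ × W => ∫ θ, supportQuotient f K w q.1 θ q.2 ∂μ := by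
  -- A Lipschitz bound in the direction uniform in the step, with continuity in the step by
  -- dominated convergence, gives joint continuity.
  refine continuous_prod_of_continuous_lipschitzWith'
    (fun q : ℝ × W => ∫ θ, supportQuotient f K w q.1 θ q.2 ∂μ)
    (M * μ.real Set.univ).toNNReal (fun ε => ?_) (fun z => ?_)
  · refine LipschitzWith.of_dist_le_mul fun z z' => ?_
    rw [dist_eq_norm, dist_eq_norm, ← integral_sub (integrable_supportQuotient hK hK0 hf hM μ ε z)
      (integrable_supportQuotient hK hK0 hf hM μ ε z')]
    refine (norm_integral_le_of_norm_le_const (C := M * ‖z - z'‖) (ae_of_all _ fun θ =>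
      abs_supportQuotient_sub_le hK hK0 hf hM ε θ z z')).trans ?_
    calc M * ‖z - z'‖ * μ.real Set.univ = M * μ.real Set.univ * ‖z - z'‖ := by ring
      _ ≤ _ := by gcongr; exact Real.le_coe_toNNReal _
  · exact continuous_of_dominated
      (fun ε => (measurable_supportQuotient hK hK0 hf hM ε z).aestronglyMeasurable)
      (fun ε => ae_of_all _ fun θ => abs_supportQuotient_le hK hK0 hf hM ε θ z)
      (integrable_const _)
      (ae_of_all _ fun θ => continuous_supportQuotient_step hK hK0 hf hM θ z)

end SupportFunction

/-! ### Uniform bounds and continuity of the projected costs -/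

section Stiefel

variable {d k N : ℕ} {p : ℝ} {x : Fin N → EuclideanSpace ℝ (Fin d)}

/-- With `EᵀE = 1`, expanding `‖v - EEᵀv‖² ≥ 0` gives `‖Eᵀv‖² ≤ ‖v‖²`. Thus one cost bound serves
all projections. -/
lemma norm_toEuclideanLin_transpose_le (E : Stiefel d k) (v : EuclideanSpace ℝ (Fin d)) :
    ‖Matrix.toEuclideanLin (E.1)ᵀ v‖ ≤ ‖v‖ := by
  refine le_of_sq_le_sq ?_ (norm_nonneg _)
  rw [EuclideanSpace.real_norm_sq_eq, EuclideanSpace.real_norm_sq_eq]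
  set w : Fin k → ℝ := (E.1)ᵀ *ᵥ v.ofLp with hw
  have h1 : (E.1 *ᵥ w) ⬝ᵥ (E.1 *ᵥ w) = w ⬝ᵥ w := by
    rw [Matrix.dotProduct_mulVec, Matrix.vecMul_mulVec, E.2]
    simp
  have h2 : v.ofLp ⬝ᵥ (E.1 *ᵥ w) = w ⬝ᵥ w := by
    rw [Matrix.dotProduct_mulVec, ← Matrix.mulVec_transpose]
  have h3 : 0 ≤ (v.ofLp - E.1 *ᵥ w) ⬝ᵥ (v.ofLp - E.1 *ᵥ w) :=
    Finset.sum_nonneg fun i _ => mul_self_nonneg _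
  rw [sub_dotProduct, dotProduct_sub, dotProduct_sub, h1, h2, dotProduct_comm (E.1 *ᵥ w) v.ofLp, h2] at h3
  have h4 : w ⬝ᵥ w ≤ v.ofLp ⬝ᵥ v.ofLp := by linarith
  simpa [dotProduct, sq, hw, Matrix.toLpLin_apply] using h4

/-- The cost matrix of the projected points. -/
def projCost (p : ℝ) (x : Fin N → EuclideanSpace ℝ (Fin d)) (E : Stiefel d k) :
    Fin N → Fin N → ℝ :=
  powerCost p (projPoints x E)

/-- A bound for the cost matrices of all projections of the points. -/
def costBound (p : ℝ) (x : Fin N → EuclideanSpace ℝ (Fin d)) : ℝ :=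
  ∑ i, ∑ j, ‖x i - x j‖ ^ p

lemma projCost_le (hp : 1 ≤ p) (E : Stiefel d k) (i j : Fin N) :
    projCost p x E i j ≤ costBound p x := by
  have h0 : ∀ i j, 0 ≤ ‖x i - x j‖ ^ p := fun i j => Real.rpow_nonneg (norm_nonneg _) _
  calc projCost p x E i j ≤ ‖x i - x j‖ ^ p := by
        refine Real.rpow_le_rpow (norm_nonneg _) ?_ (by linarith)
        rw [projPoints, projPoints, ← map_sub]
        exact norm_toEuclideanLin_transpose_le E _
    _ ≤ ∑ j, ‖x i - x j‖ ^ p :=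
        Finset.single_le_sum (f := fun j => ‖x i - x j‖ ^ p) (fun j _ => h0 i j)
          (Finset.mem_univ j)
    _ ≤ _ := Finset.single_le_sum (f := fun i => ∑ j, ‖x i - x j‖ ^ p)
          (fun i _ => Finset.sum_nonneg fun j _ => h0 i j) (Finset.mem_univ i)

lemma continuous_projCost (hp : 1 ≤ p) :
    Continuous fun E : Stiefel d k => projCost p x E := by
  have hE : Continuous fun E : Stiefel d k => E.1 := continuous_subtype_val
  refine continuous_pi fun i => continuous_pi fun j => ?_
  have hy : ∀ i, Continuous fun E : Stiefel d k => projPoints x E i := by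
    intro i
    simp only [projPoints, Matrix.toLpLin_apply]
    exact (PiLp.continuous_toLp 2 _).comp
      ((hE.matrix_transpose).matrix_mulVec continuous_const)
  exact ((hy i).sub (hy j)).norm.rpow_const fun _ => Or.inr (by linarith)

lemma costBound_nonneg : 0 ≤ costBound p x :=
  Finset.sum_nonneg fun _ _ => Finset.sum_nonneg fun _ _ => Real.rpow_nonneg (norm_nonneg _) _

end Stiefel

lemma isCompact_potentialBox {N : ℕ} (C : ℝ) : IsCompact (potentialBox N C) := isCompact_Icc

lemma potentialBox_nonempty {N : ℕ} {C : ℝ} (hC : 0 ≤ C) : (potentialBox N C).Nonempty :=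
  ⟨0, mem_potentialBox.2 fun i => by simpa using hC⟩

/-- The pair of Euclidean vectors with the given coordinates. -/
def marginals {N : ℕ} (a b : Fin N → ℝ) : EuclideanSpace ℝ (Fin N) × EuclideanSpace ℝ (Fin N) :=
  (WithLp.toLp 2 a, WithLp.toLp 2 b)

/-! ### The projected transport cost as a support function -/

section DualFunctional

variable {d k N : ℕ} [NeZero N] {p : ℝ} {x : Fin N → EuclideanSpace ℝ (Fin d)}

/-- The dual objective of the potential `u` and its `c`-transform, as a linear functional of the
pair of marginals. -/
def dualFunctional (c : Fin N → Fin N → ℝ) (u : Fin N → ℝ) :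
    EuclideanSpace ℝ (Fin N) × EuclideanSpace ℝ (Fin N) →ₗ[ℝ] ℝ where
  toFun z := u ⬝ᵥ z.1.ofLp + cTransform c u ⬝ᵥ z.2.ofLp
  map_add' z z' := by
    simp only [Prod.fst_add, Prod.snd_add, WithLp.ofLp_add, dotProduct_add]
    ring
  map_smul' t z := by
    simp only [Prod.smul_fst, Prod.smul_snd, WithLp.ofLp_smul, dotProduct_smul, smul_eq_mul,
      RingHom.id_apply]
    ring

lemma dualFunctional_apply (c : Fin N → Fin N → ℝ) (u : Fin N → ℝ)
    (z : EuclideanSpace ℝ (Fin N) × EuclideanSpace ℝ (Fin N)) :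
    dualFunctional c u z = u ⬝ᵥ z.1.ofLp + cTransform c u ⬝ᵥ z.2.ofLp := rfl

/-- The dual objective for the projected points. -/
def projDual (p : ℝ) (x : Fin N → EuclideanSpace ℝ (Fin d)) (E : Stiefel d k) (u : Fin N → ℝ) :
    EuclideanSpace ℝ (Fin N) × EuclideanSpace ℝ (Fin N) →ₗ[ℝ] ℝ :=
  dualFunctional (projCost p x E) u

lemma continuous_projDual (hp : 1 ≤ p)
    (z : EuclideanSpace ℝ (Fin N) × EuclideanSpace ℝ (Fin N)) :
    Continuous fun q : Stiefel d k × (Fin N → ℝ) => projDual p x q.1 q.2 z := by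
  simp only [projDual, dualFunctional_apply, dotProduct]
  refine (continuous_finsetSum _ fun i _ => ?_).add (continuous_finsetSum _ fun j _ => ?_)
  · fun_prop
  · refine Continuous.mul ?_ continuous_const
    exact (continuous_cTransform_uncurry j).comp
      (((continuous_projCost hp).comp continuous_fst).prodMk continuous_snd)

lemma abs_dotProduct_le {C : ℝ} {u : Fin N → ℝ} (hu : ∀ i, |u i| ≤ C)
    (z : EuclideanSpace ℝ (Fin N)) : |u ⬝ᵥ z.ofLp| ≤ N * C * ‖z‖ := by
  have hC : 0 ≤ C := (abs_nonneg (u 0)).trans (hu 0)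
  calc |u ⬝ᵥ z.ofLp| ≤ ∑ i, |u i * z.ofLp i| := Finset.abs_sum_le_sum_abs _ _
    _ ≤ ∑ _i : Fin N, C * ‖z‖ := Finset.sum_le_sum fun i _ => by
        rw [abs_mul]
        exact mul_le_mul (hu i) (PiLp.norm_apply_le z i) (abs_nonneg _) hC
    _ = N * C * ‖z‖ := by simp; ring

lemma abs_projDual_le (hp : 1 ≤ p) (E : Stiefel d k) (u : Fin N → ℝ)
    (hu : u ∈ potentialBox N (costBound p x))
    (z : EuclideanSpace ℝ (Fin N) × EuclideanSpace ℝ (Fin N)) :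
    |projDual p x E u z| ≤ 3 * N * costBound p x * ‖z‖ := by
  have hu' := mem_potentialBox.1 hu
  have hC := costBound_nonneg (p := p) (x := x)
  -- The constant `3` is one from `u`, bounded by `costBound p x`, plus two from its transform,
  -- bounded by twice that.
  have h1 := abs_dotProduct_le hu' z.1
  have h2 := abs_dotProduct_le
    (abs_cTransform_le (c := projCost p x E) powerCost_nonneg (projCost_le hp E) hu') z.2
  have h3 : N * costBound p x * ‖z.1‖ ≤ N * costBound p x * ‖z‖ := by
    gcongr; exact norm_fst_le z
  have h4 : N * (2 * costBound p x) * ‖z.2‖ ≤ N * (2 * costBound p x) * ‖z‖ := by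
    gcongr; exact norm_snd_le z
  rw [projDual, dualFunctional_apply]
  refine (abs_add_le _ _).trans ?_
  linarith

variable {a b r s : Fin N → ℝ}

/-- The support function is defined for all pairs of vectors and thus extends the cost beyond
probability vectors, so arbitrary directions are allowed. -/
lemma supportFun_projDual (hp : 1 ≤ p) (E : Stiefel d k) (ha : a ∈ stdSimplex ℝ (Fin N))
    (hb : b ∈ stdSimplex ℝ (Fin N)) :
    supportFun (projDual p x) (potentialBox N (costBound p x)) E (marginals a b)
      = wasserstein p (projPoints x E) a b ^ p := by
  rw [wasserstein_rpow hp, transportCost_eq_sSup powerCost_nonneg (projCost_le hp E)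
    powerCost_symm ha hb]
  rfl

/-- The directional derivative in a direction of mass zero is the maximum over all optimal dual
pairs. -/
lemma isGreatest_optimalDualValues (hp : 1 ≤ p) (E : Stiefel d k) (hr : r ∈ simplex N)
    (hs : s ∈ simplex N) {g h : Fin N → ℝ} (hg : ∑ i, g i = 0) (hh : ∑ i, h i = 0) :
    IsGreatest (optimalDualValues p (projPoints x E) r s g h)
      (supportDeriv (projDual p x) (potentialBox N (costBound p x)) E (marginals r s)
        (marginals g h)) := by
  have hr' := simplex_subset_stdSimplex hr
  have hs' := simplex_subset_stdSimplex hs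
  have hmax := isGreatest_supportDeriv (w := marginals r s) (z := marginals g h)
    (f := projDual p x) (isCompact_potentialBox (costBound p x))
    (potentialBox_nonempty costBound_nonneg) (continuous_projDual hp) E
  have hval : ∀ u : Fin N → ℝ, projDual p x E u (marginals g h)
      = g ⬝ᵥ u + h ⬝ᵥ cTransform (projCost p x E) u := fun u => by
    rw [projDual, dualFunctional_apply, dotProduct_comm g, dotProduct_comm h]
    rfl
  constructor
  · obtain ⟨u, hu, huv⟩ := hmax.1
    refine ⟨(u, cTransform (projCost p x E) u), ⟨?_, fun i j => add_cTransform_le i j⟩, ?_⟩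
    · rw [← supportFun_projDual hp E hr' hs']
      exact hu.2
    · rw [← huv]
      exact (hval u).symm
  · rintro _ ⟨⟨u, v⟩, ⟨h1, h2⟩, rfl⟩
    have h1' : u ⬝ᵥ r + v ⬝ᵥ s = transportCost (projCost p x E) r s :=
      h1.trans (wasserstein_rpow hp)
    obtain ⟨t, ht, hct⟩ := exists_shift_of_optimal (c := projCost p x E) powerCost_nonneg
      (projCost_le hp E) powerCost_symm hr hs h2 h1'
    refine hmax.2 ⟨fun i => u i - t, ⟨ht, ?_⟩, ?_⟩
    · rw [supportFun_projDual hp E hr' hs', ← h1]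
      have hv : v = cTransform (projCost p x E) u := eq_cTransform_of_optimal hr hs h2 h1'
      refine (dual_value_sub_const hr' hs' t).trans ?_
      rw [← hv]
    · simp only
      rw [hval, hct]
      -- The shift `t` contributes only multiples of the masses of `g` and `h`, which are zero.
      simp only [dotProduct, mul_sub, mul_add, Finset.sum_sub_distrib, Finset.sum_add_distrib,
        ← Finset.sum_mul, hg, hh]
      ring

/-! ### Integration of costs and quotients over the projections -/

section Integral

variable (μ : Measure (Stiefel d k))

/-- The integral over all projections of the extended optimal transport cost. -/
def integratedCost (p : ℝ) (x : Fin N → EuclideanSpace ℝ (Fin d))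
    (w : EuclideanSpace ℝ (Fin N) × EuclideanSpace ℝ (Fin N)) : ℝ :=
  ∫ E, supportFun (projDual p x) (potentialBox N (costBound p x)) E w ∂μ

/-- The integral over all projections of the difference quotients of the optimal transport cost. -/
def integratedQuotient (p : ℝ) (x : Fin N → EuclideanSpace ℝ (Fin d))
    (w : EuclideanSpace ℝ (Fin N) × EuclideanSpace ℝ (Fin N)) (ε : ℝ)
    (z : EuclideanSpace ℝ (Fin N) × EuclideanSpace ℝ (Fin N)) : ℝ :=
  ∫ E, supportQuotient (projDual p x) (potentialBox N (costBound p x)) w ε E z ∂μ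

lemma integratedCost_nonneg (hp : 1 ≤ p) (ha : a ∈ stdSimplex ℝ (Fin N))
    (hb : b ∈ stdSimplex ℝ (Fin N)) : 0 ≤ integratedCost μ p x (marginals a b) := by
  refine integral_nonneg fun E => ?_
  rw [Pi.zero_apply, supportFun_projDual hp E ha hb, wasserstein_rpow hp]
  exact transportCost_nonneg powerCost_nonneg

lemma IW_eq_integratedCost (hp : 1 ≤ p) (ha : a ∈ stdSimplex ℝ (Fin N))
    (hb : b ∈ stdSimplex ℝ (Fin N)) :
    IW p μ x a b = integratedCost μ p x (marginals a b) ^ (1 / p) := by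
  rw [IW, integratedCost]
  simp_rw [supportFun_projDual hp _ ha hb]

variable [IsFiniteMeasure μ]

lemma continuous_integratedQuotient (hp : 1 ≤ p)
    (w : EuclideanSpace ℝ (Fin N) × EuclideanSpace ℝ (Fin N)) :
    Continuous fun q : ℝ × EuclideanSpace ℝ (Fin N) × EuclideanSpace ℝ (Fin N) =>
      integratedQuotient μ p x w q.1 q.2 :=
  continuous_integral_supportQuotient (isCompact_potentialBox _)
    (potentialBox_nonempty costBound_nonneg) (continuous_projDual hp) (abs_projDual_le hp) μ w

lemma integrable_supportFun_projDual (hp : 1 ≤ p)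
    (w : EuclideanSpace ℝ (Fin N) × EuclideanSpace ℝ (Fin N)) :
    Integrable (fun E : Stiefel d k =>
      supportFun (projDual p x) (potentialBox N (costBound p x)) E w) μ := by
  have hK := isCompact_potentialBox (N := N) (costBound p x)
  have hK0 := potentialBox_nonempty (N := N) (costBound_nonneg (p := p) (x := x))
  refine Integrable.of_bound (C := 3 * N * costBound p x * ‖w‖)
    (continuous_supportFun_param hK (continuous_projDual hp) w).aestronglyMeasurable
    (ae_of_all _ fun E => ?_)
  have h := abs_sSup_image_sub_le (f := projDual p x) (θ := E) (abs_projDual_le hp) subset_rfl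
    hK0 w 0
  simpa [supportFun, hK0.image_const] using h

/-- This expansion has no remainder term: the nonlinearity sits in the dependence of the quotient on
`ε`. -/
lemma integratedCost_add (hp : 1 ≤ p) {ε : ℝ} (hε : 0 < ε)
    (w z : EuclideanSpace ℝ (Fin N) × EuclideanSpace ℝ (Fin N)) :
    integratedCost μ p x (w + ε • z)
      = integratedCost μ p x w + ε * integratedQuotient μ p x w ε z := by
  rw [integratedCost, integratedCost, integratedQuotient, ← integral_const_mul, ← integral_add
    (integrable_supportFun_projDual μ hp w) ((integrable_supportQuotient (isCompact_potentialBox _)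
    (potentialBox_nonempty costBound_nonneg) (continuous_projDual hp) (abs_projDual_le hp) μ ε
      z).const_mul ε)]
  congr 1
  ext E
  rw [supportQuotient, if_pos hε]
  field_simp
  ring

/-- In directions of mass zero, the derivative of the integrated cost is the integral of the maxima
over the optimal dual pairs, and these are attained and integrable. -/
lemma optimalDualValues_spec (hp : 1 ≤ p) (hr : r ∈ simplex N) (hs : s ∈ simplex N)
    {g h : Fin N → ℝ} (hg : ∑ i, g i = 0) (hh : ∑ i, h i = 0) :
    (∀ E : Stiefel d k, IsGreatest (optimalDualValues p (projPoints x E) r s g h)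
      (sSup (optimalDualValues p (projPoints x E) r s g h))) ∧
    Integrable (fun E => sSup (optimalDualValues p (projPoints x E) r s g h)) μ ∧
    ∫ E, sSup (optimalDualValues p (projPoints x E) r s g h) ∂μ
      = integratedQuotient μ p x (marginals r s) 0 (marginals g h) := by
  have hE := fun E : Stiefel d k =>
    isGreatest_optimalDualValues (x := x) hp E hr hs hg hh
  have hq : ∀ E : Stiefel d k, sSup (optimalDualValues p (projPoints x E) r s g h)
      = supportQuotient (projDual p x) (potentialBox N (costBound p x)) (marginals r s) 0 E
        (marginals g h) := fun E => by
    rw [(hE E).csSup_eq, supportQuotient, if_neg (lt_irrefl _)]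
  refine ⟨fun E => (hE E).csSup_eq ▸ hE E, ?_, ?_⟩
  · simp_rw [hq]
    exact integrable_supportQuotient (isCompact_potentialBox _)
      (potentialBox_nonempty costBound_nonneg) (continuous_projDual hp) (abs_projDual_le hp) μ 0 _
  · simp_rw [hq]
    rfl

end Integral

end DualFunctional

/-! ### The multinomial covariance -/

section Covariance

variable {d N : ℕ} {x : Fin N → EuclideanSpace ℝ (Fin d)} {r : Fin N → ℝ}

open Classical in
/-- The linear combination with coefficients `t` of the indicator functions of the points `x i`. -/
def indicatorSum (x : Fin N → EuclideanSpace ℝ (Fin d)) (t : Fin N → ℝ)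
    (y : EuclideanSpace ℝ (Fin d)) : ℝ :=
  ∑ i, if y = x i then t i else 0

@[fun_prop]
lemma measurable_indicatorSum (t : Fin N → ℝ) : Measurable (indicatorSum x t) :=
  Finset.measurable_sum _ fun i _ =>
    Measurable.ite (measurableSet_singleton (x i)) measurable_const measurable_const

lemma indicatorSum_apply (hx : Function.Injective x) (t : Fin N → ℝ) (i : Fin N) :
    indicatorSum x t (x i) = t i := by
  simp [indicatorSum, hx.eq_iff]

lemma abs_indicatorSum_le (t : Fin N → ℝ) (y : EuclideanSpace ℝ (Fin d)) :
    |indicatorSum x t y| ≤ ∑ i, |t i| := by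
  refine (Finset.abs_sum_le_sum_abs _ _).trans (Finset.sum_le_sum fun i _ => ?_)
  split_ifs <;> simp

lemma isProbabilityMeasure_discreteLaw (hr : r ∈ stdSimplex ℝ (Fin N)) :
    IsProbabilityMeasure (discreteLaw x r) := by
  constructor
  simp [discreteLaw, ← ENNReal.ofReal_sum_of_nonneg fun i _ => hr.1 i, hr.2]

lemma integral_discreteLaw (hr : r ∈ stdSimplex ℝ (Fin N)) (f : EuclideanSpace ℝ (Fin d) → ℝ) :
    ∫ y, f y ∂(discreteLaw x r) = ∑ i, r i * f (x i) := by
  rw [discreteLaw, integral_finsetSum_measure]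
  · simp [integral_smul_measure, ENNReal.toReal_ofReal (hr.1 _)]
  · exact fun i _ => (integrable_dirac (by simp)).smul_measure ENNReal.ofReal_ne_top

lemma covMatrix_mulVec (r t : Fin N → ℝ) (i : Fin N) :
    (covMatrix r *ᵥ t) i = r i * t i - r i * ∑ j, r j * t j := by
  simp only [covMatrix, Matrix.mulVec, dotProduct, Matrix.of_apply]
  have : ∀ j, (if i = j then r i * (1 - r i) else -(r i * r j)) * t j
      = (if i = j then r i * t j else 0) - r i * (r j * t j) := by
    intro j
    split_ifs with h
    · subst h; ring
    · ring
  simp [this, Finset.sum_sub_distrib, Finset.mul_sum]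

/-- Realizing the quadratic form of the covariance matrix as a variance gives its positivity and
identifies the variance in the scalar central limit theorem. -/
lemma variance_indicatorSum (hx : Function.Injective x) (hr : r ∈ stdSimplex ℝ (Fin N))
    (t : Fin N → ℝ) :
    Var[indicatorSum x t; discreteLaw x r] = t ⬝ᵥ (covMatrix r *ᵥ t) := by
  have := isProbabilityMeasure_discreteLaw (x := x) hr
  have hL : MemLp (indicatorSum x t) 2 (discreteLaw x r) :=
    MemLp.of_bound (measurable_indicatorSum t).aestronglyMeasurable (∑ i, |t i|)
      (ae_of_all _ (abs_indicatorSum_le t))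
  rw [variance_eq_sub hL]
  simp only [Pi.pow_apply]
  rw [integral_discreteLaw hr, integral_discreteLaw hr (indicatorSum x t)]
  simp only [indicatorSum_apply hx]
  simp only [dotProduct, covMatrix_mulVec, mul_sub, Finset.sum_sub_distrib]
  congr 1
  · exact Finset.sum_congr rfl fun i _ => by ring
  · rw [sq, Finset.sum_mul]
    exact Finset.sum_congr rfl fun i _ => by ring

lemma posSemidef_covMatrix (hx : Function.Injective x) (hr : r ∈ stdSimplex ℝ (Fin N)) :
    (covMatrix r).PosSemidef := by
  refine Matrix.PosSemidef.of_dotProduct_mulVec_nonneg ?_ fun t => ?_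
  · ext i j
    by_cases h : i = j
    · subst h; simp [covMatrix]
    · simp [covMatrix, h, Ne.symm h, mul_comm]
  · rw [star_trivial, ← variance_indicatorSum hx hr]
    exact variance_nonneg _ _

/-- A centered Gaussian vector with multinomial covariance has total mass zero. -/
lemma ae_sum_eq_zero (hx : Function.Injective x) (hr : r ∈ stdSimplex ℝ (Fin N))
    {Ω' : Type*} [MeasurableSpace Ω'] {P' : Measure Ω'}
    {G : Ω' → EuclideanSpace ℝ (Fin N)}
    (hG : HasLaw G (multivariateGaussian 0 (covMatrix r)) P') :
    ∀ᵐ ω ∂P', ∑ i, (G ω).ofLp i = 0 := by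
  have hmeas : Measurable fun g : EuclideanSpace ℝ (Fin N) => ∑ i, g.ofLp i := by fun_prop
  refine (hG.ae_iff (p := fun g => ∑ i, g.ofLp i = 0)
    (measurableSet_setOfPred.1 (hmeas (measurableSet_singleton 0)))).2 ?_
  set ν := multivariateGaussian (0 : EuclideanSpace ℝ (Fin N)) (covMatrix r) with hν
  -- The total mass is the inner product with the all-ones vector, which the covariance matrix
  -- annihilates.
  let e : EuclideanSpace ℝ (Fin N) := WithLp.toLp 2 fun _ => 1
  have hin : ∀ g : EuclideanSpace ℝ (Fin N), ∑ i, g.ofLp i = innerSL ℝ e g := by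
    intro g; simp [e, PiLp.inner_apply]
  have hmem : MemLp (innerSL ℝ e : EuclideanSpace ℝ (Fin N) → ℝ) 2 ν :=
    IsGaussian.memLp_dual ν _ 2 (by simp)
  have hvar : Var[(innerSL ℝ e : EuclideanSpace ℝ (Fin N) → ℝ); ν] = 0 := by
    have h1 := covarianceBilin_multivariateGaussian (μ := 0) (posSemidef_covMatrix hx hr) e e
    rw [covarianceBilin_self IsGaussian.memLp_two_id] at h1
    refine h1.trans ?_
    simp [dotProduct, covMatrix_mulVec, e, hr.2]
  have hmean : ∫ g, innerSL ℝ e g ∂ν = 0 := by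
    rw [ContinuousLinearMap.integral_comp_comm _ IsGaussian.integrable_fun_id,
      integral_id_multivariateGaussian, map_zero]
  filter_upwards [ae_eq_integral_of_variance_eq_zero hmem hvar] with g hg
  rw [hin, hg, hmean]

end Covariance
-- The multinomial central limit theorem for two samples
section CentralLimit

variable {d N : ℕ} {x : Fin N → EuclideanSpace ℝ (Fin d)} {r s : Fin N → ℝ}
  {Ω : Type*} {X Y : ℕ → Ω → EuclideanSpace ℝ (Fin d)}

open Classical in
/-- The number of occurrences of each point `x i` among the first `n` samples. -/
def occurrences (x : Fin N → EuclideanSpace ℝ (Fin d)) (X : ℕ → Ω → EuclideanSpace ℝ (Fin d))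
    (n : ℕ) (ω : Ω) : Fin N → ℕ :=
  fun i => ((Finset.range n).filter fun l => X l ω = x i).card

lemma empirical_eq (n : ℕ) (ω : Ω) :
    empirical x X n ω = fun i => (occurrences x X n ω i : ℝ) / n := rfl

/-- The rescaled deviation of the empirical distribution of `n` samples from `r`. -/
def scaledError (x : Fin N → EuclideanSpace ℝ (Fin d)) (r : Fin N → ℝ)
    (X : ℕ → Ω → EuclideanSpace ℝ (Fin d)) (n : ℕ) (ω : Ω) : EuclideanSpace ℝ (Fin N) :=
  WithLp.toLp 2 (√n • (empirical x X n ω - r))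

/-- The rescaled deviation from `r` of the empirical distribution with the given occurrences. -/
def rescaleOccurrences (r : Fin N → ℝ) (n : ℕ) (q : Fin N → ℕ) : EuclideanSpace ℝ (Fin N) :=
  WithLp.toLp 2 (√n • ((fun i => (q i : ℝ) / n) - r))

lemma measurable_rescaleOccurrences (r : Fin N → ℝ) (n : ℕ) :
    Measurable (rescaleOccurrences r n) := Measurable.of_discrete

lemma scaledError_eq (n : ℕ) :
    scaledError x r X n = rescaleOccurrences r n ∘ occurrences x X n := rfl

/-- Each linear functional of the error is a normalized centered sum of i.i.d. variables, which
reduces the vector limit to the scalar one. -/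
lemma inner_scaledError (t : EuclideanSpace ℝ (Fin N)) (n : ℕ) (ω : Ω) :
    inner ℝ (scaledError x r X n ω) t = (√n)⁻¹ *
      (∑ l ∈ Finset.range n, indicatorSum x t.ofLp (X l ω) - n * ∑ i, r i * t i) := by
  classical
  rcases Nat.eq_zero_or_pos n with rfl | hn
  · simp [scaledError]
  have hn' : (0 : ℝ) < n := by exact_mod_cast hn
  have hsum : ∑ l ∈ Finset.range n, indicatorSum x t.ofLp (X l ω)
      = ∑ i, (occurrences x X n ω i : ℝ) * t i := by
    simp only [indicatorSum]
    rw [Finset.sum_comm]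
    refine Finset.sum_congr rfl fun i _ => ?_
    simp [occurrences, Finset.sum_ite]
  have hs : √(n : ℝ) * √(n : ℝ) = n := Real.mul_self_sqrt hn'.le
  have hs0 : √(n : ℝ) ≠ 0 := (Real.sqrt_pos.2 hn').ne'
  have e : √(n : ℝ) = (√(n : ℝ))⁻¹ * n := by
    field_simp
    nlinarith
  rw [hsum, Finset.mul_sum, ← Finset.sum_sub_distrib, Finset.mul_sum]
  simp only [scaledError, PiLp.inner_apply, empirical_eq, Pi.smul_apply, Pi.sub_apply,
    smul_eq_mul, RCLike.inner_apply, conj_trivial]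
  refine Finset.sum_congr rfl fun i _ => ?_
  nth_rw 1 [e]
  field_simp

lemma occurrences_apply [DecidableEq (EuclideanSpace ℝ (Fin d))] (n : ℕ) (ω : Ω) (i : Fin N) :
    occurrences x X n ω i = ∑ l ∈ Finset.range n, if X l ω = x i then 1 else 0 := by
  rw [occurrences, Finset.card_filter]
  exact Finset.sum_congr rfl fun l _ => by congr

variable [MeasurableSpace Ω] {P : Measure Ω}

lemma aemeasurable_occurrences (hX : ∀ l, AEMeasurable (X l) P) (n : ℕ) :
    AEMeasurable (occurrences x X n) P := by
  classical
  refine aemeasurable_pi_lambda _ fun i => ?_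
  simp_rw [occurrences_apply]
  refine Finset.aemeasurable_fun_sum _ fun l _ => ?_
  have hm : Measurable fun y : EuclideanSpace ℝ (Fin d) => if y = x i then 1 else 0 :=
    Measurable.ite (measurableSet_singleton (x i)) measurable_const measurable_const
  exact hm.comp_aemeasurable (hX l)

lemma measurable_occurrences (hX : ∀ l, Measurable (X l)) (n : ℕ) :
    Measurable (occurrences x X n) := by
  classical
  refine measurable_pi_lambda _ fun i => ?_
  simp_rw [occurrences_apply]
  refine Finset.measurable_sum _ fun l _ => ?_
  exact Measurable.ite (hX l (measurableSet_singleton (x i))) measurable_const measurable_const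

/-- Every function of the two empirical distributions is almost everywhere measurable, since these
take countably many values. -/
lemma aemeasurable_comp_empirical (hX : ∀ l, AEMeasurable (X l) P)
    (hY : ∀ l, AEMeasurable (Y l) P) (n m : ℕ) (F : (Fin N → ℝ) → (Fin N → ℝ) → ℝ) :
    AEMeasurable (fun ω => F (empirical x X n ω) (empirical x Y m ω)) P := by
  let q : (Fin N → ℕ) × (Fin N → ℕ) → ℝ := fun q =>
    F (fun i => (q.1 i : ℝ) / n) (fun i => (q.2 i : ℝ) / m)
  have hq : Measurable q := Measurable.of_discrete
  have h := hq.comp_aemeasurable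
    ((aemeasurable_occurrences (x := x) hX n).prodMk (aemeasurable_occurrences (x := x) hY m))
  exact h

lemma aemeasurable_scaledError (hX : ∀ l, AEMeasurable (X l) P) (n : ℕ) :
    AEMeasurable (scaledError x r X n) P :=
  (measurable_rescaleOccurrences r n).comp_aemeasurable (aemeasurable_occurrences hX n)

/-- Independent samples have independent empirical distributions. -/
lemma indepFun_scaledError (hX : ∀ l, AEMeasurable (X l) P) (hY : ∀ l, AEMeasurable (Y l) P)
    (hXY : iIndepFun (Sum.elim X Y) P) (n m : ℕ) :
    IndepFun (scaledError x r X n) (scaledError x s Y m) P := by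
  classical
  let S : Finset (ℕ ⊕ ℕ) := (Finset.range n).map ⟨Sum.inl, Sum.inl_injective⟩
  let T : Finset (ℕ ⊕ ℕ) := (Finset.range m).map ⟨Sum.inr, Sum.inr_injective⟩
  have hST : Disjoint S T := by
    rw [Finset.disjoint_left]
    simp [S, T]
  have h := hXY.indepFun_finset₀ S T hST (by rintro (l | l); exacts [hX l, hY l])
  -- These read a sample off its finite block. The default `0` is never counted, since only indices
  -- below the sample size enter.
  let X' : ℕ → (S → EuclideanSpace ℝ (Fin d)) → EuclideanSpace ℝ (Fin d) :=
    fun l f => if hl : Sum.inl l ∈ S then f ⟨Sum.inl l, hl⟩ else 0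
  let Y' : ℕ → (T → EuclideanSpace ℝ (Fin d)) → EuclideanSpace ℝ (Fin d) :=
    fun l f => if hl : Sum.inr l ∈ T then f ⟨Sum.inr l, hl⟩ else 0
  have hX' : ∀ l, Measurable (X' l) := fun l => by
    by_cases hl : Sum.inl l ∈ S
    · simp only [X', hl, dite_true]; fun_prop
    · simp only [X', hl, dite_false]; fun_prop
  have hY' : ∀ l, Measurable (Y' l) := fun l => by
    by_cases hl : Sum.inr l ∈ T
    · simp only [Y', hl, dite_true]; fun_prop
    · simp only [Y', hl, dite_false]; fun_prop
  have h2 := h.comp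
    ((measurable_rescaleOccurrences r n).comp (measurable_occurrences (x := x) hX' n))
    ((measurable_rescaleOccurrences s m).comp (measurable_occurrences (x := x) hY' m))
  have e1 : scaledError x r X n = (rescaleOccurrences r n ∘ occurrences x X' n) ∘
      fun a (i : S) => Sum.elim X Y i a := by
    ext1 ω
    rw [scaledError_eq]
    simp only [Function.comp_apply]
    congr 1
    ext i
    simp only [occurrences_apply]
    refine Finset.sum_congr rfl fun l hl => ?_
    have hl' : Sum.inl l ∈ S := by simpa [S] using hl
    simp only [X', hl', dite_true, Sum.elim_inl]
  have e2 : scaledError x s Y m = (rescaleOccurrences s m ∘ occurrences x Y' m) ∘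
      fun a (i : T) => Sum.elim X Y i a := by
    ext1 ω
    rw [scaledError_eq]
    simp only [Function.comp_apply]
    congr 1
    ext i
    simp only [occurrences_apply]
    refine Finset.sum_congr rfl fun l hl => ?_
    have hl' : Sum.inr l ∈ T := by simpa [T] using hl
    simp only [Y', hl', dite_true, Sum.elim_inr]
  rw [e1, e2]
  exact h2

lemma charFun_map_eq_charFun_inner {E : Type*} [NormedAddCommGroup E] [InnerProductSpace ℝ E]
    [MeasurableSpace E] [BorelSpace E] [SecondCountableTopology E] {Z : Ω → E}
    (hZ : AEMeasurable Z P) (t : E) :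
    charFun (P.map Z) t = charFun (P.map fun ω => inner ℝ (Z ω) t) 1 := by
  rw [charFun_apply, charFun_apply, integral_map hZ (by fun_prop),
    integral_map (by fun_prop) (by fun_prop)]
  simp

variable [IsProbabilityMeasure P]

/-- The multinomial central limit theorem, in terms of characteristic functions. -/
lemma tendsto_charFun_scaledError (hx : Function.Injective x) (hr : r ∈ stdSimplex ℝ (Fin N))
    (hX : ∀ l, HasLaw (X l) (discreteLaw x r) P) (hind : iIndepFun X P)
    (t : EuclideanSpace ℝ (Fin N)) :
    Tendsto (fun n => charFun (P.map (scaledError x r X n)) t) atTop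
      (𝓝 (charFun (multivariateGaussian 0 (covMatrix r)) t)) := by
  have := isProbabilityMeasure_discreteLaw (x := x) hr
  let φ := indicatorSum x t.ofLp
  have hφ : Measurable φ := measurable_indicatorSum _
  have hident : ∀ l, IdentDistrib (fun ω => φ (X l ω)) (fun ω => φ (X 0 ω)) P P := fun l =>
    IdentDistrib.comp (f := X l) (g := X 0) ⟨(hX l).aemeasurable, (hX 0).aemeasurable,
      (hX l).map_eq.trans (hX 0).map_eq.symm⟩ hφ
  have hmean : P[fun ω => φ (X 0 ω)] = ∑ i, r i * t i := by
    have h := (hX 0).integral_comp (f := φ) hφ.aestronglyMeasurable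
    simp only [Function.comp_def] at h
    rw [h, integral_discreteLaw hr]
    simp [φ, indicatorSum_apply hx]
  have hvar : Var[fun ω => φ (X 0 ω); P] = t.ofLp ⬝ᵥ (covMatrix r *ᵥ t.ofLp) := by
    rw [← variance_indicatorSum hx hr, ← (hX 0).map_eq,
      variance_map hφ.aemeasurable (hX 0).aemeasurable]
    rfl
  have hmem : MemLp (fun ω => φ (X 0 ω)) 2 P :=
    MemLp.of_bound (hφ.comp_aemeasurable (hX 0).aemeasurable).aestronglyMeasurable (∑ i, |t i|)
      (ae_of_all _ fun ω => abs_indicatorSum_le _ _)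
  have hclt := tendstoInDistribution_inv_sqrt_mul_sum_sub (X := fun l ω => φ (X l ω)) (P := P)
    (Y := id) (P' := gaussianReal 0 Var[fun ω => φ (X 0 ω); P].toNNReal) HasLaw.id hmem
    (hind.comp (fun _ => φ) fun _ => hφ) hident
  have hlim := ProbabilityMeasure.tendsto_iff_tendsto_charFun.1 hclt.tendsto 1
  simp only [ProbabilityMeasure.coe_mk, Measure.map_id] at hlim
  have e1 : charFun (gaussianReal 0 Var[fun ω => φ (X 0 ω); P].toNNReal) 1
      = charFun (multivariateGaussian 0 (covMatrix r)) t := by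
    rw [charFun_gaussianReal, charFun_multivariateGaussian (posSemidef_covMatrix hx hr), hvar,
      Real.coe_toNNReal _ (by rw [← variance_indicatorSum hx hr]; exact variance_nonneg _ _)]
    simp
  rw [e1] at hlim
  refine hlim.congr fun n => ?_
  rw [charFun_map_eq_charFun_inner (aemeasurable_scaledError (fun l => (hX l).aemeasurable) n)]
  simp only [inner_scaledError, hmean]
  rfl

/-- Joint convergence of the two rescaled empirical distributions. -/
lemma tendstoInDistribution_scaledError (hx : Function.Injective x)
    (hr : r ∈ stdSimplex ℝ (Fin N)) (hs : s ∈ stdSimplex ℝ (Fin N))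
    (hX : ∀ l, HasLaw (X l) (discreteLaw x r) P) (hY : ∀ l, HasLaw (Y l) (discreteLaw x s) P)
    (hXY : iIndepFun (Sum.elim X Y) P)
    {Ω' : Type*} [MeasurableSpace Ω'] {P' : Measure Ω'} [IsProbabilityMeasure P']
    {G H : Ω' → EuclideanSpace ℝ (Fin N)}
    (hG : HasLaw G (multivariateGaussian 0 (covMatrix r)) P')
    (hH : HasLaw H (multivariateGaussian 0 (covMatrix s)) P')
    (hGH : IndepFun G H P') {n m : ℕ → ℕ} (hn : Tendsto n atTop atTop)
    (hm : Tendsto m atTop atTop) :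
    TendstoInDistribution
      (fun t ω => (scaledError x r X (n t) ω, scaledError x s Y (m t) ω)) atTop
      (fun ω => (G ω, H ω)) (fun _ => P) P' := by
  have hXm := fun l => (hX l).aemeasurable
  have hYm := fun l => (hY l).aemeasurable
  have hXi : iIndepFun X P :=
    iIndepFun.precomp (f := Sum.elim X Y) (g := Sum.inl) Sum.inl_injective hXY
  have hYi : iIndepFun Y P :=
    iIndepFun.precomp (f := Sum.elim X Y) (g := Sum.inr) Sum.inr_injective hXY
  have hA := fun n => aemeasurable_scaledError (x := x) (r := r) hXm n
  have hB := fun n => aemeasurable_scaledError (x := x) (r := s) hYm n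
  -- The `L²` product supplies the inner product needed for characteristic functions, which factor
  -- by independence; the last line returns to the ordinary product.
  have hto : Measurable (WithLp.toLp 2 :
      EuclideanSpace ℝ (Fin N) × EuclideanSpace ℝ (Fin N) → WithLp 2 _) := by fun_prop
  have key : TendstoInDistribution (fun t ω =>
      WithLp.toLp 2 (scaledError x r X (n t) ω, scaledError x s Y (m t) ω)) atTop
      (fun ω => WithLp.toLp 2 (G ω, H ω)) (fun _ => P) P' :=
    { forall_aemeasurable := fun t => hto.comp_aemeasurable ((hA (n t)).prodMk (hB (m t)))
      aemeasurable_limit := hto.comp_aemeasurable (hG.aemeasurable.prodMk hH.aemeasurable)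
      tendsto := by
        refine ProbabilityMeasure.tendsto_iff_tendsto_charFun.2 fun t => ?_
        simp only [ProbabilityMeasure.coe_mk]
        rw [(indepFun_iff_charFun_prod hG.aemeasurable hH.aemeasurable).1 hGH t, hG.map_eq,
          hH.map_eq]
        simp_rw [fun i => (indepFun_iff_charFun_prod (hA (n i)) (hB (m i))).1
          (indepFun_scaledError hXm hYm hXY (n i) (m i)) t]
        exact ((tendsto_charFun_scaledError hx hr hX hXi _).comp
          hn).mul ((tendsto_charFun_scaledError hx hs hY hYi _).comp
          hm) }
  exact key.continuous_comp (WithLp.prod_continuous_ofLp 2 _ _)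

/-- Mixing independent Gaussian vectors with the same multinomial covariance reproduces their
law. -/
lemma hasLaw_sqrt_smul_sub (hx : Function.Injective x) (hr : r ∈ stdSimplex ℝ (Fin N))
    {Ω' : Type*} [MeasurableSpace Ω'] {P' : Measure Ω'} [IsProbabilityMeasure P']
    {G H : Ω' → EuclideanSpace ℝ (Fin N)}
    (hG : HasLaw G (multivariateGaussian 0 (covMatrix r)) P')
    (hH : HasLaw H (multivariateGaussian 0 (covMatrix r)) P')
    (hGH : IndepFun G H P') {δ : ℝ} (hδ : δ ∈ Set.Ioo (0 : ℝ) 1) :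
    HasLaw (fun ω => √δ • G ω - √(1 - δ) • H ω) (multivariateGaussian 0 (covMatrix r)) P' := by
  have hGm := hG.aemeasurable
  have hHm := hH.aemeasurable
  refine ⟨by fun_prop, ?_⟩
  have : IsProbabilityMeasure (P'.map fun ω => √δ • G ω - √(1 - δ) • H ω) :=
    Measure.isProbabilityMeasure_map (by fun_prop)
  refine Measure.ext_of_charFun ?_
  ext t
  have hind : IndepFun (fun ω => √δ • G ω) (fun ω => (-√(1 - δ)) • H ω) P' :=
    hGH.comp (φ := fun g => √δ • g) (ψ := fun h => (-√(1 - δ)) • h) (by fun_prop) (by fun_prop)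
  have e : (fun ω => √δ • G ω - √(1 - δ) • H ω)
      = fun ω => √δ • G ω + (-√(1 - δ)) • H ω := by
    ext1 ω; rw [neg_smul, sub_eq_add_neg]
  rw [e, hind.charFun_map_fun_add_eq_mul (by fun_prop) (by fun_prop), Pi.mul_apply,
    charFun_map_smul_comp hGm, charFun_map_smul_comp hHm, hG.map_eq, hH.map_eq,
    charFun_multivariateGaussian (posSemidef_covMatrix hx hr),
    charFun_multivariateGaussian (posSemidef_covMatrix hx hr),
    charFun_multivariateGaussian (posSemidef_covMatrix hx hr), ← Complex.exp_add]
  congr 1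
  have h1 : √δ * √δ = δ := Real.mul_self_sqrt hδ.1.le
  have h2 : √(1 - δ) * √(1 - δ) = 1 - δ := Real.mul_self_sqrt (by linarith [hδ.2])
  simp only [inner_zero_right, Complex.ofReal_zero, zero_mul, zero_sub, WithLp.ofLp_smul,
    Matrix.mulVec_smul, smul_dotProduct, dotProduct_smul, smul_eq_mul, ← mul_assoc, neg_mul_neg,
    h1, h2]
  push_cast
  ring

end CentralLimit

/-- Convergence in distribution only depends on the tail of the sequence and on the law of the
limit. -/
lemma _root_.MeasureTheory.TendstoInDistribution.congr_of_eventually {ι E Ω Ω' : Type*}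
    [TopologicalSpace E] [MeasurableSpace E] [OpensMeasurableSpace E] [MeasurableSpace Ω]
    [MeasurableSpace Ω'] {P : Measure Ω} [IsProbabilityMeasure P] {P' : Measure Ω'}
    [IsProbabilityMeasure P'] {l : Filter ι} {X Y : ι → Ω → E} {Z T : Ω' → E}
    (h : TendstoInDistribution X l Z (fun _ => P) P') (hXY : ∀ᶠ i in l, X i =ᵐ[P] Y i)
    (hY : ∀ i, AEMeasurable (Y i) P) (hT : AEMeasurable T P') (hZT : P'.map Z = P'.map T) :
    TendstoInDistribution Y l T (fun _ => P) P' where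
  forall_aemeasurable := hY
  aemeasurable_limit := hT
  tendsto := by
    have e : (⟨P'.map Z, Measure.isProbabilityMeasure_map h.aemeasurable_limit⟩ :
        ProbabilityMeasure E) = ⟨P'.map T, Measure.isProbabilityMeasure_map hT⟩ :=
      Subtype.ext hZT
    rw [← e]
    refine h.tendsto.congr' ?_
    filter_upwards [hXY] with i hi
    exact Subtype.ext (Measure.map_congr hi)

/-! ### Effective sample size -/

section SampleSizes

variable {n m : ℕ → ℕ} {δ : ℝ}

/-- The effective sample size `n m / (n + m)`. -/
def effectiveSize (n m : ℕ) : ℝ := (n : ℝ) * (m : ℝ) / ((n : ℝ) + (m : ℝ))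

lemma effectiveSize_pos {n m : ℕ} (hn : 0 < n) (hm : 0 < m) : 0 < effectiveSize n m := by
  have : (0 : ℝ) < n := by exact_mod_cast hn
  have : (0 : ℝ) < m := by exact_mod_cast hm
  unfold effectiveSize
  positivity

lemma sqrt_effectiveSize_left {n m : ℕ} :
    √(effectiveSize n m) = √((m : ℝ) / (n + m)) * √(n : ℝ) := by
  rw [← Real.sqrt_mul (by positivity), effectiveSize]
  congr 1
  ring

lemma sqrt_effectiveSize_right {n m : ℕ} (hn : 0 < n) :
    √(effectiveSize n m) = √(1 - (m : ℝ) / (n + m)) * √(m : ℝ) := by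
  have h : (0 : ℝ) < n := by exact_mod_cast hn
  have e : 1 - (m : ℝ) / (n + m) = n / (n + m) := by field_simp; ring
  rw [e, ← Real.sqrt_mul (by positivity), effectiveSize]
  congr 1
  ring

lemma tendsto_effectiveSize (hn : Tendsto n atTop atTop) (hδ : 0 < δ)
    (hnm : Tendsto (fun t => (m t : ℝ) / ((n t : ℝ) + (m t : ℝ))) atTop (𝓝 δ)) :
    Tendsto (fun t => effectiveSize (n t) (m t)) atTop atTop := by
  have h := (tendsto_natCast_atTop_atTop (R := ℝ)).comp hn
  refine (h.atTop_mul_pos hδ hnm).congr fun t => ?_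
  simp only [Function.comp_apply, effectiveSize]
  ring

end SampleSizes

/-! ### Assembling the limit theorem -/

section Main

variable {d k N : ℕ} {p : ℝ} {x : Fin N → EuclideanSpace ℝ (Fin d)} {r s : Fin N → ℝ}
  {Ω : Type*} {X Y : ℕ → Ω → EuclideanSpace ℝ (Fin d)}

/-- The effective rate equals `√(m/(n+m)) * √n` and `√(1 - m/(n+m)) * √m`; the deterministic weights
tend to `√δ` and `√(1 - δ)`. -/
lemma marginals_empirical_eq {n m : ℕ} (hn : 0 < n) (hm : 0 < m) (ω : Ω) :
    marginals (empirical x X n ω) (empirical x Y m ω) = marginals r s +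
      (√(effectiveSize n m))⁻¹ • (√((m : ℝ) / (n + m)) • scaledError x r X n ω,
        √(1 - (m : ℝ) / (n + m)) • scaledError x s Y m ω) := by
  have h0 := (Real.sqrt_pos.2 (effectiveSize_pos hn hm)).ne'
  have e1 : √((m : ℝ) / (n + m)) • scaledError x r X n ω
      = √(effectiveSize n m) • WithLp.toLp 2 (empirical x X n ω - r) := by
    rw [scaledError, WithLp.toLp_smul, smul_smul, ← sqrt_effectiveSize_left]
  have e2 : √(1 - (m : ℝ) / (n + m)) • scaledError x s Y m ω
      = √(effectiveSize n m) • WithLp.toLp 2 (empirical x Y m ω - s) := by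
    rw [scaledError, WithLp.toLp_smul, smul_smul, ← sqrt_effectiveSize_right hn]
  rw [e1, e2, Prod.smul_mk, smul_smul, smul_smul, inv_mul_cancel₀ h0, one_smul, one_smul]
  simp [marginals]

variable [MeasurableSpace Ω] {P : Measure Ω}

lemma ae_empirical_mem_stdSimplex (hx : Function.Injective x)
    (hX : ∀ l, HasLaw (X l) (discreteLaw x r) P) {n : ℕ} (hn : 0 < n) :
    ∀ᵐ ω ∂P, empirical x X n ω ∈ stdSimplex ℝ (Fin N) := by
  have hsupp : ∀ᵐ ω ∂P, ∀ l, X l ω ∈ Set.range x := by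
    refine ae_all_iff.2 fun l => ?_
    refine ((hX l).ae_iff (p := fun y => y ∈ Set.range x)
      (measurableSet_setOfPred.1 (Set.finite_range x).measurableSet)).2 ?_
    have hnull : MeasurableSet (Set.range x)ᶜ := (Set.finite_range x).measurableSet.compl
    change discreteLaw x r (Set.range x)ᶜ = 0
    simp [discreteLaw, Measure.dirac_apply' _ hnull]
  filter_upwards [hsupp] with ω hω
  have hn' : (0 : ℝ) < n := by exact_mod_cast hn
  refine ⟨fun i => by rw [empirical_eq]; positivity, ?_⟩
  classical
  simp only [empirical_eq, ← Finset.sum_div, occurrences_apply]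
  rw [div_eq_one_iff_eq hn'.ne']
  push_cast
  rw [Finset.sum_comm]
  have : ∀ l, ∑ i, (if X l ω = x i then (1 : ℝ) else 0) = 1 := fun l => by
    obtain ⟨i, hi⟩ := hω l
    simp [← hi, hx.eq_iff]
  simp [this]

variable [IsProbabilityMeasure P]

/-- The rescaled deviations of the empirical distributions, together with the step size, converge
in distribution after applying a continuous map. -/
lemma tendstoInDistribution_comp_deviations (hx : Function.Injective x)
    (hr : r ∈ stdSimplex ℝ (Fin N)) (hs : s ∈ stdSimplex ℝ (Fin N))
    (hX : ∀ l, HasLaw (X l) (discreteLaw x r) P) (hY : ∀ l, HasLaw (Y l) (discreteLaw x s) P)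
    (hXY : iIndepFun (Sum.elim X Y) P)
    {Ω' : Type*} [MeasurableSpace Ω'] {P' : Measure Ω'} [IsProbabilityMeasure P']
    {G H : Ω' → EuclideanSpace ℝ (Fin N)}
    (hG : HasLaw G (multivariateGaussian 0 (covMatrix r)) P')
    (hH : HasLaw H (multivariateGaussian 0 (covMatrix s)) P')
    (hGH : IndepFun G H P') {n m : ℕ → ℕ} (hn : Tendsto n atTop atTop)
    (hm : Tendsto m atTop atTop) {δ : ℝ} (hδ : 0 < δ)
    (hnm : Tendsto (fun t => (m t : ℝ) / ((n t : ℝ) + (m t : ℝ))) atTop (𝓝 δ))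
    {Ψ : ℝ × EuclideanSpace ℝ (Fin N) × EuclideanSpace ℝ (Fin N) → ℝ} (hΨ : Continuous Ψ) :
    TendstoInDistribution (fun t ω => Ψ ((√(effectiveSize (n t) (m t)))⁻¹,
        √((m t : ℝ) / (n t + m t)) • scaledError x r X (n t) ω,
        √(1 - (m t : ℝ) / (n t + m t)) • scaledError x s Y (m t) ω)) atTop
      (fun ω => Ψ (0, √δ • G ω, √(1 - δ) • H ω)) (fun _ => P) P' := by
  have hconst : TendstoInMeasure P (fun (t : ℕ) (_ : Ω) => ((√(effectiveSize (n t) (m t)))⁻¹,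
      √((m t : ℝ) / (n t + m t)), √(1 - (m t : ℝ) / (n t + m t)))) atTop
      (fun _ => ((0 : ℝ), √δ, √(1 - δ))) := by
    refine tendstoInMeasure_of_tendsto_ae (fun _ => aestronglyMeasurable_const)
      (ae_of_all _ fun _ => ?_)
    refine Tendsto.prodMk_nhds ?_ (Tendsto.prodMk_nhds ?_ ?_)
    · exact tendsto_inv_atTop_zero.comp
        (Real.tendsto_sqrt_atTop.comp (tendsto_effectiveSize hn hδ hnm))
    · exact (Real.continuous_sqrt.tendsto _).comp hnm
    · exact (Real.continuous_sqrt.tendsto _).comp (hnm.const_sub 1)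
  -- Slutsky's theorem: the step and the two weights are deterministic and converge, the errors
  -- converge jointly in law.
  exact (tendstoInDistribution_scaledError hx hr hs hX hY hXY hG hH hGH hn
    hm).continuous_comp_prodMk_of_tendstoInMeasure_const
    (g := fun q => Ψ (q.2.1, q.2.2.1 • q.1.1, q.2.2.2 • q.1.2)) (by fun_prop) hconst
    (fun _ => aemeasurable_const)

variable [NeZero N] {μ : Measure (Stiefel d k)}

lemma integratedCost_self (hp : 1 ≤ p) (hr : r ∈ stdSimplex ℝ (Fin N)) :
    integratedCost μ p x (marginals r r) = 0 := by
  simp_rw [integratedCost, supportFun_projDual hp _ hr hr, wasserstein_rpow hp,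
    transportCost_self powerCost_nonneg (powerCost_self hp) hr]
  simp

lemma integral_potentialValues [IsFiniteMeasure μ] (hp : 1 ≤ p) (hr : r ∈ simplex N) {g h : Fin N → ℝ}
    (hg : ∑ i, g i = 0) (hh : ∑ i, h i = 0) :
    ∫ E, sSup (potentialValues p (projPoints x E) (g - h)) ∂μ
      = integratedQuotient μ p x (marginals r r) 0 (marginals g h) := by
  rw [← (optimalDualValues_spec μ hp hr hr hg hh).2.2]
  simp_rw [optimalDualValues_self hp hr]

end Main

end IPRW

end

theorem theorem2 {d k N : ℕ} (hk : 1 ≤ k) (hkd : k ≤ d) (p : ℝ) (hp : 1 ≤ p)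
    (x : Fin N → EuclideanSpace ℝ (Fin d)) (hx : Function.Injective x)
    (μ : Measure (IPRW.Stiefel d k)) [IsFiniteMeasure μ]
    (r s : Fin N → ℝ) (hr : r ∈ IPRW.simplex N) (hs : s ∈ IPRW.simplex N)
    -- the two independent i.i.d. samples
    {Ω : Type*} [MeasurableSpace Ω] (P : Measure Ω) [IsProbabilityMeasure P]
    (X Y : ℕ → Ω → EuclideanSpace ℝ (Fin d))
    (hX : ∀ l, HasLaw (X l) (IPRW.discreteLaw x r) P)
    (hY : ∀ l, HasLaw (Y l) (IPRW.discreteLaw x s) P)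
    (hXY : iIndepFun (Sum.elim X Y) P)
    -- the two independent Gaussian vectors
    {Ω' : Type*} [MeasurableSpace Ω'] (P' : Measure Ω') [IsProbabilityMeasure P']
    (G H : Ω' → EuclideanSpace ℝ (Fin N))
    (hG : HasLaw G (multivariateGaussian 0 (IPRW.covMatrix r)) P')
    (hH : HasLaw H (multivariateGaussian 0 (IPRW.covMatrix s)) P')
    (hGH : IndepFun G H P')
    -- the sample sizes
    (n m : ℕ → ℕ) (hn : Tendsto n atTop atTop) (hm : Tendsto m atTop atTop)
    (δ : ℝ) (hδ : δ ∈ Set.Ioo (0 : ℝ) 1)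
    (hnm : Tendsto (fun t => (m t : ℝ) / ((n t : ℝ) + (m t : ℝ))) atTop (𝓝 δ)) :
    (r = s →
      -- the maxima in the limit are attained and their integral exists
      (∀ᵐ ω ∂P',
        (∀ E : IPRW.Stiefel d k, IsGreatest (IPRW.potentialValues p (IPRW.projPoints x E) (G ω).ofLp)
          (sSup (IPRW.potentialValues p (IPRW.projPoints x E) (G ω).ofLp))) ∧
        Integrable
          (fun E => sSup (IPRW.potentialValues p (IPRW.projPoints x E) (G ω).ofLp)) μ) ∧
      TendstoInDistribution
        (fun (t : ℕ) (ω : Ω) =>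
          ((n t : ℝ) * (m t : ℝ) / ((n t : ℝ) + (m t : ℝ))) ^ (1 / (2 * p)) *
            IPRW.IW p μ x (IPRW.empirical x X (n t) ω) (IPRW.empirical x Y (m t) ω))
        atTop
        (fun ω =>
          (∫ E, sSup (IPRW.potentialValues p (IPRW.projPoints x E) (G ω).ofLp) ∂μ) ^ (1 / p))
        (fun _ => P) P') ∧
    -- positivity of `IW` only serves to give the power `IW ^ (1 - p)` a meaning
    (r ≠ s → (p = 1 ∨ 0 < IPRW.IW p μ x r s) →
      (∀ᵐ ω ∂P',
        (∀ E : IPRW.Stiefel d k, IsGreatest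
          (IPRW.optimalDualValues p (IPRW.projPoints x E) r s
            (√δ • (G ω).ofLp) (√(1 - δ) • (H ω).ofLp))
          (sSup (IPRW.optimalDualValues p (IPRW.projPoints x E) r s
            (√δ • (G ω).ofLp) (√(1 - δ) • (H ω).ofLp)))) ∧
        Integrable
          (fun E => sSup (IPRW.optimalDualValues p (IPRW.projPoints x E) r s
            (√δ • (G ω).ofLp) (√(1 - δ) • (H ω).ofLp))) μ) ∧
      TendstoInDistribution
        (fun (t : ℕ) (ω : Ω) =>
          √((n t : ℝ) * (m t : ℝ) / ((n t : ℝ) + (m t : ℝ))) *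
            (IPRW.IW p μ x (IPRW.empirical x X (n t) ω) (IPRW.empirical x Y (m t) ω) -
              IPRW.IW p μ x r s))
        atTop
        (fun ω =>
          1 / p * IPRW.IW p μ x r s ^ (1 - p) *
            ∫ E, sSup (IPRW.optimalDualValues p (IPRW.projPoints x E) r s
              (√δ • (G ω).ofLp) (√(1 - δ) • (H ω).ofLp)) ∂μ)
        (fun _ => P) P') := by
  have : NeZero N := ⟨by rintro rfl; simpa using hr.2⟩
  have hr' := IPRW.simplex_subset_stdSimplex hr
  have hs' := IPRW.simplex_subset_stdSimplex hs
  have hp0 : (0 : ℝ) < p := by linarith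
  have hG0 := IPRW.ae_sum_eq_zero hx hr' hG
  have hH0 := IPRW.ae_sum_eq_zero hx hs' hH
  have hXm := fun l => (hX l).aemeasurable
  have hYm := fun l => (hY l).aemeasurable
  have hGm := hG.aemeasurable
  have hlarge : ∀ᶠ t in atTop, 0 < n t ∧ 0 < m t :=
    (hn.eventually_gt_atTop 0).and (hm.eventually_gt_atTop 0)
  have hQ := IPRW.continuous_integratedQuotient (x := x) μ hp (IPRW.marginals r s)
  have hsmul : ∀ (c : ℝ) (g : Fin N → ℝ), ∑ i, g i = 0 → ∑ i, (c • g) i = 0 := fun c g hg => by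
    simp [← Finset.mul_sum, hg]
  refine ⟨?_, ?_⟩
  · rintro rfl
    -- Pairing `G` with the zero direction makes the difference `g - h` equal to `G` itself.
    have hzero : ∑ i : Fin N, (0 : Fin N → ℝ) i = 0 := by simp
    refine ⟨?_, ?_⟩
    · filter_upwards [hG0] with ω hω
      have h := IPRW.optimalDualValues_spec (x := x) μ hp hr hr hω hzero
      simp only [IPRW.optimalDualValues_self hp hr, sub_zero] at h
      exact ⟨h.1, h.2.1⟩
    · -- the limit as a continuous function of one Gaussian vector
      let L : EuclideanSpace ℝ (Fin N) → ℝ := fun v =>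
        IPRW.integratedQuotient μ p x (IPRW.marginals r r) 0 (v, 0) ^ (1 / p)
      have hL : Measurable L := by
        have : Continuous L := (hQ.comp (by fun_prop :
          Continuous fun v : EuclideanSpace ℝ (Fin N) => ((0 : ℝ), v,
            (0 : EuclideanSpace ℝ (Fin N))))).rpow_const fun _ => Or.inr (by positivity)
        exact this.measurable
      have hLint : ∀ v : EuclideanSpace ℝ (Fin N), ∑ i, v.ofLp i = 0 →
          (∫ E, sSup (IPRW.potentialValues p (IPRW.projPoints x E) v.ofLp) ∂μ) ^ (1 / p)
            = L v := fun v hv => by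
        have h := IPRW.integral_potentialValues (x := x) (μ := μ) hp hr hv hzero
        rw [sub_zero] at h
        rw [h]
        rfl
      have hlimG : (fun ω => L (G ω)) =ᵐ[P'] fun ω =>
          (∫ E, sSup (IPRW.potentialValues p (IPRW.projPoints x E) (G ω).ofLp) ∂μ) ^ (1 / p) := by
        filter_upwards [hG0] with ω hω
        exact (hLint _ hω).symm
      have hLG : AEMeasurable (fun ω => L (G ω)) P' := hL.comp_aemeasurable hGm
      have hmix := IPRW.hasLaw_sqrt_smul_sub hx hr' hG hH hGH hδ
      have hconv := IPRW.tendstoInDistribution_comp_deviations hx hr' hr' hX hY hXY hG hH hGH hn hm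
        hδ.1 hnm (hQ.rpow_const (p := 1 / p) fun _ => Or.inr (by positivity))
      refine hconv.congr_of_eventually ?_ (fun t => ?_) (hLG.congr hlimG) ?_
      · filter_upwards [hlarge] with t ht
        filter_upwards [IPRW.ae_empirical_mem_stdSimplex hx hX ht.1,
          IPRW.ae_empirical_mem_stdSimplex hx hY ht.2] with ω h1 h2
        have hρ := IPRW.effectiveSize_pos ht.1 ht.2
        have hsq := Real.sqrt_pos.2 hρ
        have hadd := IPRW.integratedCost_add (x := x) μ hp (inv_pos.2 hsq) (IPRW.marginals r r)
          (√((m t : ℝ) / (n t + m t)) • IPRW.scaledError x r X (n t) ω,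
            √(1 - (m t : ℝ) / (n t + m t)) • IPRW.scaledError x r Y (m t) ω)
        rw [← IPRW.marginals_empirical_eq ht.1 ht.2, IPRW.integratedCost_self hp hr',
          zero_add] at hadd
        have hnn := IPRW.integratedCost_nonneg (x := x) μ hp h1 h2
        rw [IPRW.IW_eq_integratedCost μ hp h1 h2]
        change _ = IPRW.effectiveSize (n t) (m t) ^ (1 / (2 * p)) * _
        -- The base cost is zero, so `IW` is the `1/p` power of `ε` times the quotient, and this
        -- prefactor cancels `ε` exactly.
        have e1 : IPRW.effectiveSize (n t) (m t) ^ (1 / (2 * p))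
            = √(IPRW.effectiveSize (n t) (m t)) ^ (1 / p) := by
          rw [Real.sqrt_eq_rpow, ← Real.rpow_mul hρ.le]
          congr 1
          field_simp
        rw [e1, ← Real.mul_rpow hsq.le hnn, hadd, mul_inv_cancel_left₀ hsq.ne']
      · exact (IPRW.aemeasurable_comp_empirical hXm hYm (n t) (m t)
          (fun a b => IPRW.IW p μ x a b)).const_mul _
      -- For equal marginals the limit depends on the two directions only through their difference,
      -- which has the law of `G`.
      · have e1 : (fun ω => IPRW.integratedQuotient μ p x (IPRW.marginals r r) 0
            (√δ • G ω, √(1 - δ) • H ω) ^ (1 / p))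
            =ᵐ[P'] fun ω => L (√δ • G ω - √(1 - δ) • H ω) := by
          filter_upwards [hG0, hH0] with ω h1 h2
          have h1' := hsmul √δ _ h1
          have h2' := hsmul √(1 - δ) _ h2
          have h0 : ∑ i, (√δ • G ω - √(1 - δ) • H ω).ofLp i = 0 := by
            simp only [WithLp.ofLp_sub, WithLp.ofLp_smul, Pi.sub_apply, Finset.sum_sub_distrib,
              h1', h2', sub_zero]
          rw [← hLint _ h0]
          have h := IPRW.integral_potentialValues (x := x) (μ := μ) hp hr h1' h2'
          exact congrArg (· ^ (1 / p)) h.symm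
        rw [Measure.map_congr e1, ← Measure.map_congr hlimG]
        have m1 : P'.map (fun ω => L (√δ • G ω - √(1 - δ) • H ω))
            = (P'.map fun ω => √δ • G ω - √(1 - δ) • H ω).map L :=
          (AEMeasurable.map_map_of_aemeasurable hL.aemeasurable hmix.aemeasurable).symm
        have m2 : P'.map (fun ω => L (G ω)) = (P'.map G).map L :=
          (AEMeasurable.map_map_of_aemeasurable hL.aemeasurable hGm).symm
        rw [m1, m2, hmix.map_eq, hG.map_eq]
  · intro _ hpos
    have hspec := (hG0.and hH0).mono fun ω h => IPRW.optimalDualValues_spec (x := x) μ hp hr hs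
      (hsmul √δ _ h.1) (hsmul √(1 - δ) _ h.2)
    refine ⟨by filter_upwards [hspec] with ω h using ⟨h.1, h.2.1⟩, ?_⟩
    set F₀ := IPRW.integratedCost μ p x (IPRW.marginals r s) with hF₀
    have hF₀nn : 0 ≤ F₀ := IPRW.integratedCost_nonneg μ hp hr' hs'
    have hIW : IPRW.IW p μ x r s = F₀ ^ (1 / p) := IPRW.IW_eq_integratedCost μ hp hr' hs'
    let φ : ℝ → ℝ := fun y => y ^ (1 / p)
    have hφc : Continuous φ := continuous_id.rpow_const fun _ => Or.inr (by positivity)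
    have hφd : HasDerivAt φ (1 / p * F₀ ^ (1 / p - 1)) F₀ := by
      refine Real.hasDerivAt_rpow_const ?_
      -- For `p = 1` the power is the identity, so `F₀ = 0` is harmless; otherwise positivity of
      -- `IW` gives `F₀ ≠ 0`.
      rcases hpos with rfl | hpos
      · exact Or.inr (by simp)
      · refine Or.inl fun h => ?_
        rw [hIW, h, Real.zero_rpow (by positivity)] at hpos
        exact lt_irrefl _ hpos
    have hderiv : deriv φ F₀ = 1 / p * IPRW.IW p μ x r s ^ (1 - p) := by
      rw [hφd.deriv, hIW, ← Real.rpow_mul hF₀nn]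
      congr 2
      field_simp
    have hds : Continuous (dslope φ F₀) := by
      rw [← continuousOn_univ, continuousOn_dslope univ_mem]
      exact ⟨hφc.continuousOn, hφd.differentiableAt⟩
    -- The increment of `φ` from `F₀` to `F₀ + ε * Q` is `ε * Q` times `dslope`; dropping `ε` leaves
    -- a function continuous down to `ε = 0`.
    have hconv := IPRW.tendstoInDistribution_comp_deviations hx hr' hs' hX hY hXY hG hH hGH hn hm
      hδ.1 hnm (Ψ := fun q => IPRW.integratedQuotient μ p x (IPRW.marginals r s) q.1 q.2 *
        dslope φ F₀ (F₀ + q.1 * IPRW.integratedQuotient μ p x (IPRW.marginals r s) q.1 q.2))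
      (hQ.mul (hds.comp (continuous_const.add (continuous_fst.mul hQ))))
    have hlim : (fun ω => IPRW.integratedQuotient μ p x (IPRW.marginals r s) 0
          (√δ • G ω, √(1 - δ) • H ω) * dslope φ F₀ (F₀ + 0 *
          IPRW.integratedQuotient μ p x (IPRW.marginals r s) 0 (√δ • G ω, √(1 - δ) • H ω)))
        =ᵐ[P'] fun ω => 1 / p * IPRW.IW p μ x r s ^ (1 - p) *
            ∫ E, sSup (IPRW.optimalDualValues p (IPRW.projPoints x E) r s
              (√δ • (G ω).ofLp) (√(1 - δ) • (H ω).ofLp)) ∂μ := by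
      filter_upwards [hspec] with ω h
      rw [h.2.2, zero_mul, add_zero, dslope_same, hderiv, mul_comm]
      rfl
    refine hconv.congr_of_eventually ?_ (fun t => ?_) (hconv.aemeasurable_limit.congr hlim)
      (Measure.map_congr hlim)
    · filter_upwards [hlarge] with t ht
      filter_upwards [IPRW.ae_empirical_mem_stdSimplex hx hX ht.1,
        IPRW.ae_empirical_mem_stdSimplex hx hY ht.2] with ω h1 h2
      have hsq := Real.sqrt_pos.2 (IPRW.effectiveSize_pos ht.1 ht.2)
      have hadd := IPRW.integratedCost_add (x := x) μ hp (inv_pos.2 hsq) (IPRW.marginals r s)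
        (√((m t : ℝ) / (n t + m t)) • IPRW.scaledError x r X (n t) ω,
          √(1 - (m t : ℝ) / (n t + m t)) • IPRW.scaledError x s Y (m t) ω)
      rw [← IPRW.marginals_empirical_eq ht.1 ht.2, ← hF₀] at hadd
      rw [IPRW.IW_eq_integratedCost μ hp h1 h2, hIW, hadd]
      change _ = √(IPRW.effectiveSize (n t) (m t)) * (φ _ - φ F₀)
      rw [← sub_smul_dslope φ F₀, add_sub_cancel_left, smul_eq_mul, mul_assoc,
        mul_inv_cancel_left₀ hsq.ne']
    · exact ((IPRW.aemeasurable_comp_empirical hXm hYm (n t) (m t)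
        (fun a b => IPRW.IW p μ x a b)).sub_const _).const_mul _
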